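/- Let $j,k\ge 1$ and $n$ be integers with $j+k<n$. For $0<i<n$ let $G(n,i)$ be the set of all unoriented affine $i$-planes in $\mathbb R^n$. Every $\tau\in G(n,i)$ is written uniquely as $\tau=\xi+u$, where $\xi$ is an $i$-dimensional linear subspace and $u\in\xi^\perp$; $|\tau|=|u|$ is the distance from $\tau$ to the origin, and $G(n,i)$ carries the measure $d\tau=d\xi\,du$, where $d\xi$ is the $O(n)$-invariant probability measure on the Grassmannian of $i$-dimensional linear subspaces of $\mathbb R^n$ and $du$ is the Euclidean volume on $\xi^\perp$. For a function $f$ on $G(n,j)$ and $\zeta=\eta+v\in G(n,k)$, $v\in\eta^\perp$, let $$(R_{j,k}f)(\zeta)=\int_{G_j(\eta^\perp)}d\xi\int_{\eta} f(\xi+u+v)\,du,$$ where $G_j(\eta^\perp)$ is the Grassmannian of $j$-dimensional linear subspaces of $\eta^\perp$ with its $O(\eta^\perp)$-invariant probability measure; $R_{k,j}$, which takes functions on $G(n,k)$ to functions on $G(n,j)$, is the same operator with $j$ and $k$ interchanged. **Theorem.** Let $f$ and $\varphi$ be measurable complex-valued functions on $G(n,j)$ and $G(n,k)$, respectively. Then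 $$\int_{G(n,k)}\frac{(R_{j,k}f)(\zeta)}{|\zeta|^{\lambda}}\,d\zeta=c_{k,j}\int_{G(n,j)}\frac{f(\tau)}{|\tau|^{\lambda-j}}\,d\tau,\qquad j<\lambda<n-k,$$ $$\int_{G(n,k)}\frac{(R_{j,k}f)(\zeta)}{(1+|\zeta|^2)^{n/2}}\,d\zeta=c_{j}\int_{G(n,j)}\frac{f(\tau)}{(1+|\tau|^2)^{(n-j-k)/2}}\,d\tau,$$ $$\int_{G(n,j)}\frac{(R_{k,j}\varphi)(\tau)}{|\tau|^{\lambda}}\,d\tau=c_{j,k}\int_{G(n,k)}\frac{\varphi(\zeta)}{|\zeta|^{\lambda-k}}\,d\zeta,\qquad k<\lambda<n-j,$$ $$\int_{G(n,j)}\frac{(R_{k,j}\varphi)(\tau)}{(1+|\tau|^2)^{n/2}}\,d\tau=c_{k}\int_{G(n,k)}\frac{\varphi(\zeta)}{(1+|\zeta|^2)^{(n-j-k)/2}}\,d\zeta,$$ where $$c_{j,k}=\frac{\pi^{k/2}\,\Gamma(\frac{n-k}{2})\,\Gamma(\frac{\lambda-k}{2})\,\Gamma(\frac{n-j-\lambda}{2})}{\Gamma(\frac{n-j-k}{2})\,\Gamma(\frac{\lambda}{2})\,\Gamma(\frac{n-\lambda}{2})},\qquad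 c_{k,j}=\frac{\pi^{j/2}\,\Gamma(\frac{n-j}{2})\,\Gamma(\frac{\lambda-j}{2})\,\Gamma(\frac{n-k-\lambda}{2})}{\Gamma(\frac{n-j-k}{2})\,\Gamma(\frac{\lambda}{2})\,\Gamma(\frac{n-\lambda}{2})},$$ $$c_k=\frac{\pi^{k/2}\,\Gamma(\frac{n-k}{2})}{\Gamma(\frac n2)},\qquad c_j=\frac{\pi^{j/2}\,\Gamma(\frac{n-j}{2})}{\Gamma(\frac n2)}.$$ Each formula holds provided that the integral on at least one of its two sides exists in the Lebesgue sense, that is, converges absolutely: it is finite when $f$ (respectively $\varphi$) is replaced by $|f|$ (respectively $|\varphi|$), on the left-hand side also inside the Radon transform. In that case the integral on the other side exists in the same sense, and $(R_{j,k}f)(\zeta)$ (respectively $(R_{k,j}\varphi)(\tau)$) is an absolutely convergent integral for almost all $\zeta$ (respectively $\tau$). -/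

import Mathlib

open MeasureTheory Module
open scoped ENNReal

noncomputable section

/-! ### The orthogonal group and its invariant probability measure -/

/-- The orthogonal group `O(d)`, as a group of matrices. -/
abbrev OrthGroup (d : ℕ) : Type := Matrix.orthogonalGroup (Fin d) ℝ

instance OrthGroup.instMeasurableSpace (d : ℕ) : MeasurableSpace (OrthGroup d) := borel _

instance OrthGroup.instBorelSpace (d : ℕ) : BorelSpace (OrthGroup d) := ⟨rfl⟩

instance OrthGroup.instCompactSpace (d : ℕ) : CompactSpace (OrthGroup d) := by
  suffices h : IsCompact (Matrix.orthogonalGroup (Fin d) ℝ : Set (Matrix (Fin d) (Fin d) ℝ)) from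
    isCompact_iff_compactSpace.mp h
  have hK : IsCompact (Set.univ.pi fun _ : Fin d => Set.univ.pi fun _ : Fin d =>
      Set.Icc (-1 : ℝ) 1) :=
    isCompact_univ_pi fun _ => isCompact_univ_pi fun _ => isCompact_Icc
  refine IsCompact.of_isClosed_subset hK ?_ ?_
  · have h : ((Matrix.orthogonalGroup (Fin d) ℝ : Submonoid (Matrix (Fin d) (Fin d) ℝ)) :
        Set (Matrix (Fin d) (Fin d) ℝ)) = {A | A * star A = 1} := by
      ext A
      exact Matrix.mem_orthogonalGroup_iff (Fin d) ℝ
    rw [h]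
    exact isClosed_eq (by fun_prop) continuous_const
  · intro A hA
    have hb := fun a b => entry_norm_bound_of_unitary (𝕜 := ℝ) hA a b
    intro a _ b _
    exact abs_le.mp (hb a b)

/-- The invariant probability measure `dρ` on `O(d)`. -/
def orthHaar (d : ℕ) : Measure (OrthGroup d) := Measure.haarMeasure ⊤

/-! ### Grassmannians of linear subspaces -/

section Linear

variable (V : Type*) [NormedAddCommGroup V] [InnerProductSpace ℝ V] [FiniteDimensional ℝ V]

/-- The Grassmannian `G_j(V)` of all `j`-dimensional linear subspaces of `V`. -/
def Gr (j : ℕ) : Type _ := {ξ : Submodule ℝ V // finrank ℝ ξ = j}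

/-- The usual topology of `G_j(V)`: subspaces are identified with orthogonal projections. -/
instance Gr.instTopologicalSpace (j : ℕ) : TopologicalSpace (Gr V j) :=
  TopologicalSpace.induced (fun ξ : Gr V j => (ξ.1.starProjection : V →L[ℝ] V)) inferInstance

instance Gr.instMeasurableSpace (j : ℕ) : MeasurableSpace (Gr V j) := borel _

instance Gr.instBorelSpace (j : ℕ) : BorelSpace (Gr V j) := ⟨rfl⟩

variable {V}

/-- The vectors of `V` whose coordinates, in a fixed orthonormal basis of `V`, are the first `j`
columns of the matrix `ρ`. -/
def firstColumns {j : ℕ} (h : j ≤ finrank ℝ V) (ρ : OrthGroup (finrank ℝ V)) (a : Fin j) : V :=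
  ∑ i, (ρ.1 i (Fin.castLE h a)) • (stdOrthonormalBasis ℝ V i)

theorem orthonormal_firstColumns {j : ℕ} (h : j ≤ finrank ℝ V) (ρ : OrthGroup (finrank ℝ V)) :
    Orthonormal ℝ (firstColumns h ρ) := by
  rw [orthonormal_iff_ite]
  intro a b
  have hρ : star ρ.1 * ρ.1 = 1 := (Matrix.mem_orthogonalGroup_iff' _ ℝ).mp ρ.2
  have h1 := congrFun (congrFun hρ (Fin.castLE h a)) (Fin.castLE h b)
  rw [Matrix.mul_apply, Matrix.one_apply] at h1
  simp only [firstColumns, (stdOrthonormalBasis ℝ V).orthonormal.inner_sum]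
  simpa [Matrix.star_apply] using h1

/-- The image `ρ E_j` of the span `E_j` of the first `j` vectors of a fixed orthonormal basis
of `V` under the orthogonal map with matrix `ρ`. -/
def Gr.ofOrth {j : ℕ} (h : j ≤ finrank ℝ V) (ρ : OrthGroup (finrank ℝ V)) : Gr V j :=
  ⟨Submodule.span ℝ (Set.range (firstColumns h ρ)), by
    simpa using finrank_span_eq_card (orthonormal_firstColumns h ρ).linearIndependent⟩

variable (V)

/-- The `O(V)`-invariant probability measure on `G_j(V)`, `0 ≤ j ≤ dim V`: the image of the
invariant probability measure on the orthogonal group under `ρ ↦ ρ E_j`.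
(`G_j(V)` is empty for `j > dim V`.) -/
def grMeasure (j : ℕ) : Measure (Gr V j) :=
  if h : j ≤ finrank ℝ V then (orthHaar (finrank ℝ V)).map (Gr.ofOrth h) else 0

end Linear

/-! ### Grassmannians of affine planes in `ℝⁿ` -/

/-- The Euclidean space `ℝⁿ`. -/
abbrev Euc (n : ℕ) : Type := EuclideanSpace ℝ (Fin n)

/-- The affine Grassmannian `G(n, j)` of all (unoriented) affine `j`-planes in `ℝⁿ`. -/
def AffGr (n j : ℕ) : Type :=
  {τ : AffineSubspace ℝ (Euc n) // (τ : Set (Euc n)).Nonempty ∧ finrank ℝ τ.direction = j}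

variable {n : ℕ}

/-- The point of the plane `τ` that is closest to the origin: if `τ = ξ + u` with `u ∈ ξᗮ`,
this is `u`. -/
def AffGr.foot {j : ℕ} (τ : AffGr n j) : Euc n :=
  haveI : Nonempty τ.1 := τ.2.1.to_subtype
  (EuclideanGeometry.orthogonalProjection τ.1 0 : τ.1)

/-- The distance `|τ|` between the plane `τ` and the origin. -/
def AffGr.dist0 {j : ℕ} (τ : AffGr n j) : ℝ := Metric.infDist 0 (τ.1 : Set (Euc n))

/-- The affine plane `ξ + x`. -/
def Gr.shift {j : ℕ} (ξ : Gr (Euc n) j) (x : Euc n) : AffGr n j :=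
  ⟨AffineSubspace.mk' x ξ.1, ⟨x, AffineSubspace.self_mem_mk' x ξ.1⟩, by
    rw [AffineSubspace.direction_mk']; exact ξ.2⟩

/-- The usual topology of `G(n, j)`: the plane `ξ + u`, `u ∈ ξᗮ`, is identified with the pair
formed by the orthogonal projection onto `ξ` and the vector `u`. -/
instance AffGr.instTopologicalSpace (n j : ℕ) : TopologicalSpace (AffGr n j) :=
  TopologicalSpace.induced
    (fun τ : AffGr n j => ((τ.1.direction.starProjection : Euc n →L[ℝ] Euc n), τ.foot))
    inferInstance

instance AffGr.instMeasurableSpace (n j : ℕ) : MeasurableSpace (AffGr n j) := borel _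

instance AffGr.instBorelSpace (n j : ℕ) : BorelSpace (AffGr n j) := ⟨rfl⟩

/-- The measure `dτ = dξ du` on `G(n, j)`: `ξ` is distributed according to the invariant
probability measure on `G_j(ℝⁿ)` and `du` is the Euclidean volume on `ξᗮ`. -/
def affMeasure (n j : ℕ) : Measure (AffGr n j) :=
  (grMeasure (Euc n) j).bind fun ξ =>
    (volume : Measure ↥(ξ.1ᗮ)).map fun u : ↥(ξ.1ᗮ) => ξ.shift (u : Euc n)

/-! ### The mixed Radon transform -/

/-- A `j`-dimensional subspace of a subspace `X` of `ℝⁿ`, as a subspace of `ℝⁿ`. -/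
def Gr.lift {j : ℕ} {X : Submodule ℝ (Euc n)} (ξ : Gr X j) : Gr (Euc n) j :=
  ⟨ξ.1.map X.subtype, by rw [X.finrank_map_subtype_eq]; exact ξ.2⟩

/-- The mixed `j`-plane to `k`-plane Radon transform. For `ζ = η + v`, `v ∈ ηᗮ`,
`(R_{j,k} f)(ζ) = ∫_{ξ ∈ G_j(ηᗮ)} dξ ∫_{u ∈ η} f(ξ + u + v) du`. -/
def mixedRadon (j k : ℕ) (f : AffGr n j → ℂ) (ζ : AffGr n k) : ℂ :=
  ∫ ξ : Gr ↥(ζ.1.directionᗮ) j, ∫ u : ζ.1.direction,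
    f (ξ.lift.shift ((u : Euc n) + ζ.foot)) ∂volume ∂(grMeasure ↥(ζ.1.directionᗮ) j)

/-- `(R_{j,k} |f|)(ζ)`, as an element of `[0, ∞]`. -/
def mixedRadonAbs (j k : ℕ) (f : AffGr n j → ℂ) (ζ : AffGr n k) : ℝ≥0∞ :=
  ∫⁻ ξ : Gr ↥(ζ.1.directionᗮ) j, ∫⁻ u : ζ.1.direction,
    ‖f (ξ.lift.shift ((u : Euc n) + ζ.foot))‖ₑ ∂volume ∂(grMeasure ↥(ζ.1.directionᗮ) j)

/-- The integral that defines `(R_{j,k} f)(ζ)` exists in the Lebesgue sense. -/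
def MixedRadonExists (j k : ℕ) (f : AffGr n j → ℂ) (ζ : AffGr n k) : Prop :=
  Integrable
    (fun p : Gr ↥(ζ.1.directionᗮ) j × ζ.1.direction =>
      f (p.1.lift.shift ((p.2 : Euc n) + ζ.foot)))
    ((grMeasure ↥(ζ.1.directionᗮ) j).prod volume)

/-- The formula `∫ (R_{j,k} f)(ζ) w(ζ) dζ = c ∫ f(τ) w'(τ) dτ` holds, provided that the integral
on either side exists in the Lebesgue sense. The integral on the left (which contains the integral
that defines `R_{j,k} f`) exists if it is finite for `|f|` in place of `f`. If one of the two
integrals exists, then both do, and in particular `(R_{j,k} f)(ζ)` exists for almost all `ζ`. -/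
def RadonFormula (j k : ℕ) (f : AffGr n j → ℂ) (w : AffGr n k → ℝ) (w' : AffGr n j → ℝ)
    (c : ℝ) : Prop :=
  ((∫⁻ ζ, mixedRadonAbs j k f ζ * ENNReal.ofReal (w ζ) ∂(affMeasure n k) < ∞) ∨
      Integrable (fun τ => f τ * (w' τ : ℂ)) (affMeasure n j)) →
    (∫⁻ ζ, mixedRadonAbs j k f ζ * ENNReal.ofReal (w ζ) ∂(affMeasure n k) < ∞) ∧
    (∀ᵐ ζ ∂(affMeasure n k), MixedRadonExists j k f ζ) ∧
    Integrable (fun ζ => mixedRadon j k f ζ * (w ζ : ℂ)) (affMeasure n k) ∧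
    Integrable (fun τ => f τ * (w' τ : ℂ)) (affMeasure n j) ∧
    ∫ ζ, mixedRadon j k f ζ * (w ζ : ℂ) ∂(affMeasure n k) =
      (c : ℂ) * ∫ τ, f τ * (w' τ : ℂ) ∂(affMeasure n j)

/-- The constant `c_{j,k}` (which depends also on `n` and `μ`). -/
def powConst (n j k : ℕ) (μ : ℝ) : ℝ :=
  Real.pi ^ ((k : ℝ) / 2) * Real.Gamma (((n : ℝ) - k) / 2) * Real.Gamma ((μ - k) / 2) *
      Real.Gamma (((n : ℝ) - j - μ) / 2) /
    (Real.Gamma (((n : ℝ) - j - k) / 2) * Real.Gamma (μ / 2) * Real.Gamma (((n : ℝ) - μ) / 2))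

/-- The constant `c_k` (which depends also on `n`). -/
def ratConst (n k : ℕ) : ℝ :=
  Real.pi ^ ((k : ℝ) / 2) * Real.Gamma (((n : ℝ) - k) / 2) / Real.Gamma ((n : ℝ) / 2)

end

noncomputable section

set_option linter.unusedSectionVars false

/-! ### The orthogonal group acting on Euclidean space -/

/-! It is enough to prove each formula for nonnegative measurable `F` in place of `f`, and to prove
the two formulas for `R_{j,k}`; those for `R_{k,j}` follow by interchanging `j` and `k`.

Fix orthogonal subspaces `X ⟂ Y` of dimensions `j` and `k`. The measure on `G(n,k)` is the image of
Haar measure times Lebesgue measure on `Yᗮ` under `(g, v) ↦ g(Y + v)` (`affMeasure_eq_map`), so the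
left side is an integral over `g`, `v ∈ Yᗮ`, `ξ ∈ G_j(Yᗮ)` and `u ∈ Y`. Isometries fixing `Y` act
transitively on the `j`-planes orthogonal to `Y`, and Haar measure is right invariant, so `ξ` may be
replaced by `X`. The variables `u` and `v` combine to `x ∈ ℝⁿ`, which leaves `flagIntegral`: the
integral over `g` and `x` of `F(g(X + x)) w(|x - P_Y x|)` (`lintegral_radonKernel_eq_flagIntegral`).

Now split `x = y + z` along `X ⊕ Xᗮ` instead. The factor `F` sees only `z`, so `y` integrates out of
the weight and leaves a function `W` of `|z - P_Y z|`. The result holds for every `Y ⊆ Xᗮ`, so it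
may be averaged over `G_k(Xᗮ)`; the average of `W` is `c w'(|z|)`, which gives the right side
(`lintegral_radonKernel_mul`).

Thus only two radial computations depend on the weight. The integral over `X` is a Gamma integral
(`lintegral_rpow_neg_norm_sq_add`). The mean over `G_k(Xᗮ)` comes from integrating a Gaussian in two
ways (`lintegral_grMeasure_norm_rpow`, `lintegral_grMeasure_one_add_norm_rpow`).

For complex `f`, the transform is integration against an s-finite kernel, and the nonnegative
identity says that this kernel carries the measure `w dζ` to `c w' dτ`. Existence on either side is
then integrability against one and the same measure, and the formula is Fubini for kernels
(`radonFormula_of_lintegral`). -/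

/-- Orthogonal matrices are the linear isometries of Euclidean space. -/
def orthIso (d : ℕ) : OrthGroup d ≃* (Euc d ≃ₗᵢ[ℝ] Euc d) :=
  (Unitary.mapEquiv
    { toMulEquiv := (Matrix.toEuclideanCLM (n := Fin d) (𝕜 := ℝ) : _ ≃* _)
      map_star' := map_star (Matrix.toEuclideanCLM (n := Fin d) (𝕜 := ℝ)) }).toMulEquiv.trans
    Unitary.linearIsometryEquiv

theorem coe_orthIso {d : ℕ} (ρ : OrthGroup d) :
    ((orthIso d ρ : Euc d ≃L[ℝ] Euc d) : Euc d →L[ℝ] Euc d) =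
      Matrix.toEuclideanCLM (n := Fin d) (𝕜 := ℝ) ρ.1 := rfl

theorem continuous_orthIso (d : ℕ) : Continuous fun ρ : OrthGroup d =>
    ((orthIso d ρ : Euc d ≃L[ℝ] Euc d) : Euc d →L[ℝ] Euc d) := by
  simp only [coe_orthIso]
  exact (LinearMap.continuous_of_finiteDimensional
    (Matrix.toEuclideanCLM (n := Fin d) (𝕜 := ℝ)).toAlgEquiv.toLinearMap).comp
    continuous_subtype_val

/-- Needed to test measurability on Grassmannians after pulling back along a surjective orbit map:
the source of that map has to be standard Borel. -/
instance OrthGroup.instPolishSpace (d : ℕ) : PolishSpace (OrthGroup d) := by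
  have : PolishSpace (Matrix (Fin d) (Fin d) ℝ) :=
    inferInstanceAs (PolishSpace (Fin d → Fin d → ℝ))
  refine IsClosed.polishSpace
    (s := (Matrix.orthogonalGroup (Fin d) ℝ : Set (Matrix (Fin d) (Fin d) ℝ))) ?_
  exact (isCompact_iff_compactSpace.mpr (OrthGroup.instCompactSpace d)).isClosed

instance OrthGroup.instIsTopologicalGroup (d : ℕ) : IsTopologicalGroup (OrthGroup d) :=
  inferInstanceAs (IsTopologicalGroup (unitary (Matrix (Fin d) (Fin d) ℝ)))

instance orthHaar.instIsHaarMeasure (d : ℕ) : (orthHaar d).IsHaarMeasure := by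
  unfold orthHaar; infer_instance

instance orthHaar.instIsProbabilityMeasure (d : ℕ) : IsProbabilityMeasure (orthHaar d) :=
  ⟨by
    simpa [orthHaar] using Measure.haarMeasure_self (K₀ := (⊤ : TopologicalSpace.PositiveCompacts (OrthGroup d)))⟩

/-- A right translate of the measure is again a Haar probability measure, and such a measure is
unique. -/
instance orthHaar.instIsMulRightInvariant (d : ℕ) : (orthHaar d).IsMulRightInvariant := by
  refine ⟨fun g => ?_⟩
  have : IsProbabilityMeasure ((orthHaar d).map (· * g)) :=
    Measure.isProbabilityMeasure_map (by fun_prop)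
  exact Measure.isHaarMeasure_eq_of_isProbabilityMeasure _ _

/-! ### Isometries acting on Grassmannians -/

section Gr

variable {V V' V'' : Type*} [NormedAddCommGroup V] [InnerProductSpace ℝ V] [FiniteDimensional ℝ V]
  [NormedAddCommGroup V'] [InnerProductSpace ℝ V'] [FiniteDimensional ℝ V']
  [NormedAddCommGroup V''] [InnerProductSpace ℝ V''] [FiniteDimensional ℝ V''] {j k : ℕ}

/-- The image of a subspace under a linear isometry. -/
def Gr.push (T : V →ₗᵢ[ℝ] V') (ξ : Gr V j) : Gr V' j :=
  ⟨ξ.1.map T.toLinearMap, (LinearEquiv.finrank_eq (Submodule.equivMapOfInjective _ T.injective _)).symm.trans ξ.2⟩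

theorem Gr.push_push (T : V →ₗᵢ[ℝ] V') (S : V' →ₗᵢ[ℝ] V'') (ξ : Gr V j) :
    (ξ.push T).push S = ξ.push (S.comp T) :=
  Subtype.ext (Submodule.map_comp _ _ _).symm

/-- The topology of the Grassmannian is defined by projections; this conjugation formula is what
makes the action of isometries continuous. -/
theorem starProjection_map_isometry (T : V →ₗᵢ[ℝ] V') (X : Submodule ℝ V) :
    (X.map T.toLinearMap).starProjection =
      T.toContinuousLinearMap ∘L X.starProjection ∘L
        (ContinuousLinearMap.adjoint T.toContinuousLinearMap) := by
  ext x
  refine Submodule.eq_starProjection_of_mem_of_inner_eq_zero ?_ ?_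
  · exact ⟨_, Submodule.starProjection_apply_mem X _, rfl⟩
  · rintro _ ⟨y, hy, rfl⟩
    have h := Submodule.starProjection_inner_eq_zero
      (ContinuousLinearMap.adjoint T.toContinuousLinearMap x) y hy
    have h2 : inner ℝ x (T y) =
        inner ℝ (ContinuousLinearMap.adjoint T.toContinuousLinearMap x) y :=
      (ContinuousLinearMap.adjoint_inner_left T.toContinuousLinearMap y x).symm
    rw [inner_sub_left, sub_eq_zero] at h ⊢
    simpa [h2] using h

theorem Gr.continuous_push_of_continuous {Ω : Type*} [TopologicalSpace Ω] {T : Ω → V →ₗᵢ[ℝ] V'}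
    {ξ : Ω → Gr V j} (hT : Continuous fun ω => (T ω).toContinuousLinearMap) (hξ : Continuous ξ) :
    Continuous fun ω => (ξ ω).push (T ω) := by
  refine continuous_induced_rng.2 ?_
  have h : Continuous fun ω => ((ξ ω).1.starProjection : V →L[ℝ] V) :=
    continuous_induced_dom.comp hξ
  have h2 : Continuous fun ω => ContinuousLinearMap.adjoint (T ω).toContinuousLinearMap :=
    (LinearIsometryEquiv.continuous _).comp hT
  refine (hT.clm_comp (h.clm_comp h2)).congr fun ω => ?_
  exact (starProjection_map_isometry (T ω) (ξ ω).1).symm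

theorem Gr.continuous_push (T : V →ₗᵢ[ℝ] V') : Continuous (Gr.push (j := j) T) :=
  Gr.continuous_push_of_continuous continuous_const continuous_id

theorem Gr.injective_starProjection :
    Function.Injective fun ξ : Gr V j => (ξ.1.starProjection : V →L[ℝ] V) := by
  intro ξ η h
  apply Subtype.ext
  have := congrArg (fun T : V →L[ℝ] V => LinearMap.range T.toLinearMap) h
  simpa using this

instance Gr.instSecondCountableTopology : SecondCountableTopology (Gr V j) := by
  have : SecondCountableTopology (V →L[ℝ] V) := inferInstance
  exact TopologicalSpace.secondCountableTopology_induced _ _ _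

instance Gr.instT2Space : T2Space (Gr V j) :=
  T2Space.of_injective_continuous Gr.injective_starProjection continuous_induced_dom

/-- Isometries act transitively on pairs of orthogonal subspaces. -/
theorem exists_isometry_map_pair {X Y X' Y' : Submodule ℝ V} (h : X ⟂ Y) (h' : X' ⟂ Y')
    (hX : finrank ℝ X = finrank ℝ X') (hY : finrank ℝ Y = finrank ℝ Y') :
    ∃ T : V ≃ₗᵢ[ℝ] V, X.map T.toLinearIsometry.toLinearMap = X' ∧
      Y.map T.toLinearIsometry.toLinearMap = Y' := by
  -- Orthonormal bases of the two subspaces are joined and extended to one of `V`. The index type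
  -- depends only on dimensions, so the bases obtained from both pairs can be matched term by term.
  have key : ∀ {A B : Submodule ℝ V}, A ⟂ B → ∀ (a : OrthonormalBasis (Fin (finrank ℝ X)) ℝ A)
      (b : OrthonormalBasis (Fin (finrank ℝ Y)) ℝ B),
      ∃ (c : OrthonormalBasis ((Fin (finrank ℝ X) ⊕ Fin (finrank ℝ Y)) ⊕
        Fin (finrank ℝ V - (finrank ℝ X + finrank ℝ Y))) ℝ V),
        (∀ i, c (Sum.inl (Sum.inl i)) = a i) ∧ ∀ i, c (Sum.inl (Sum.inr i)) = b i := by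
    intro A B hAB a b
    set w : Fin (finrank ℝ X) ⊕ Fin (finrank ℝ Y) → V :=
      Sum.elim (fun i => (a i : V)) (fun i => (b i : V)) with hw
    have how : Orthonormal ℝ w := by
      rw [orthonormal_iff_ite]
      have ha := orthonormal_iff_ite.1 a.orthonormal
      have hb := orthonormal_iff_ite.1 b.orthonormal
      rintro (i | i) (l | l)
      · simpa [hw] using ha i l
      · simpa [hw] using hAB.inner_eq (a i).2 (b l).2
      · simpa [hw] using hAB.symm.inner_eq (b i).2 (a l).2
      · simpa [hw] using hb i l
    have hcard : finrank ℝ V = Fintype.card ((Fin (finrank ℝ X) ⊕ Fin (finrank ℝ Y)) ⊕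
        Fin (finrank ℝ V - (finrank ℝ X + finrank ℝ Y))) := by
      have := how.linearIndependent.fintype_card_le_finrank
      simp only [Fintype.card_sum, Fintype.card_fin] at this ⊢
      omega
    have hor : Orthonormal ℝ ((Set.range Sum.inl).domRestrict
        (Sum.elim w 0 : _ ⊕ Fin (finrank ℝ V - (finrank ℝ X + finrank ℝ Y)) → V)) := by
      rw [orthonormal_iff_ite]
      rintro ⟨_, i, rfl⟩ ⟨_, l, rfl⟩
      simpa [Subtype.ext_iff] using orthonormal_iff_ite.1 how i l
    obtain ⟨c, hc⟩ := hor.exists_orthonormalBasis_extension_of_card_eq hcard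
    exact ⟨c, fun i => by simpa [hw] using hc (Sum.inl (Sum.inl i)) ⟨_, rfl⟩,
      fun i => by simpa [hw] using hc (Sum.inl (Sum.inr i)) ⟨_, rfl⟩⟩
  have img : ∀ {m : ℕ} {A A' : Submodule ℝ V} (a : OrthonormalBasis (Fin m) ℝ A)
      (a' : OrthonormalBasis (Fin m) ℝ A') (T : V ≃ₗᵢ[ℝ] V), (∀ i, T (a i) = a' i) →
      A.map T.toLinearIsometry.toLinearMap = A' := by
    intro m A A' a a' T hT
    have span : ∀ {B : Submodule ℝ V} (b : OrthonormalBasis (Fin m) ℝ B),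
        B = Submodule.span ℝ (Set.range fun i => (b i : V)) := by
      intro B b
      have h1 := congrArg (Submodule.map B.subtype) b.toBasis.span_eq
      rw [Submodule.map_span, Submodule.map_top, Submodule.range_subtype, ← Set.range_comp] at h1
      simpa [Function.comp_def] using h1.symm
    rw [span a, span a', Submodule.map_span, ← Set.range_comp]
    congr 2
    ext i
    simpa using hT i
  let a := stdOrthonormalBasis ℝ X
  let b := stdOrthonormalBasis ℝ Y
  let a' := (stdOrthonormalBasis ℝ X').reindex (finCongr hX.symm)
  let b' := (stdOrthonormalBasis ℝ Y').reindex (finCongr hY.symm)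
  obtain ⟨c, hc1, hc2⟩ := key h a b
  obtain ⟨c', hc1', hc2'⟩ := key h' a' b'
  refine ⟨c.equiv c' (Equiv.refl _), img a a' _ fun i => ?_, img b b' _ fun i => ?_⟩
  · rw [← hc1, ← hc1', OrthonormalBasis.equiv_apply_basis, Equiv.refl_apply]
  · rw [← hc2, ← hc2', OrthonormalBasis.equiv_apply_basis, Equiv.refl_apply]

/-- The isometry is the reflection in the hyperplane orthogonal to `x - y`. -/
theorem exists_isometry_apply {x y : V} (h : ‖x‖ = ‖y‖) : ∃ T : V ≃ₗᵢ[ℝ] V, T x = y :=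
  ⟨_, Submodule.reflection_sub h⟩

end Gr

section Gr

variable {V V' V'' : Type*} [NormedAddCommGroup V] [InnerProductSpace ℝ V] [FiniteDimensional ℝ V]
  [NormedAddCommGroup V'] [InnerProductSpace ℝ V'] [FiniteDimensional ℝ V']
  [NormedAddCommGroup V''] [InnerProductSpace ℝ V''] [FiniteDimensional ℝ V''] {j k : ℕ}

theorem Gr.exists_push_eq (X Y : Gr V j) :
    ∃ T : V ≃ₗᵢ[ℝ] V, X.push T.toLinearIsometry = Y := by
  obtain ⟨T, hT, -⟩ := exists_isometry_map_pair (Submodule.isOrtho_bot_right (U := X.1))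
    (Submodule.isOrtho_bot_right (U := Y.1)) (X.2.trans Y.2.symm) rfl
  exact ⟨T, Subtype.ext hT⟩

/-- The coordinate plane spanned by the first `j` standard basis vectors. -/
def coordGr {d j : ℕ} (h : j ≤ d) : Gr (Euc d) j :=
  ⟨Submodule.span ℝ (Set.range fun a : Fin j =>
    (EuclideanSpace.single (Fin.castLE h a) 1 : Euc d)), by
    have : Orthonormal ℝ (fun a : Fin j => (EuclideanSpace.single (Fin.castLE h a) 1 : Euc d)) :=
      EuclideanSpace.orthonormal_single.comp _ (Fin.castLE_injective h)
    simpa using finrank_span_eq_card this.linearIndependent⟩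

theorem Gr.ofOrth_eq_push (h : j ≤ finrank ℝ V) (ρ : OrthGroup (finrank ℝ V)) :
    Gr.ofOrth h ρ = (coordGr h).push
      ((stdOrthonormalBasis ℝ V).repr.symm.toLinearIsometry.comp
        (orthIso _ ρ).toLinearIsometry) := by
  apply Subtype.ext
  simp only [Gr.ofOrth, Gr.push, coordGr, Submodule.map_span, ← Set.range_comp]
  congr 2
  funext a
  set b := stdOrthonormalBasis ℝ V
  change firstColumns h ρ a = b.repr.symm (orthIso _ ρ (EuclideanSpace.single (Fin.castLE h a) 1))
  rw [← b.sum_repr_symm]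
  refine Finset.sum_congr rfl fun i _ => ?_
  congr 1
  change _ = (ρ.1.mulVec (Pi.single (Fin.castLE h a) 1)) i
  simp

theorem continuous_push_comp_orthIso {m : ℕ} (T : Euc m →ₗᵢ[ℝ] V) :
    Continuous fun p : OrthGroup m × Gr (Euc m) j =>
      p.2.push (T.comp (orthIso m p.1).toLinearIsometry) := by
  refine Gr.continuous_push_of_continuous ?_ continuous_snd
  exact (continuous_const (y := T.toContinuousLinearMap)).clm_comp
    ((continuous_orthIso m).comp continuous_fst)

/-- The invariant measure depends neither on the orthonormal frame nor on the base plane: changing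
the frame multiplies `ρ` on the left, changing the plane multiplies it on the right, and Haar
measure is invariant under both. -/
theorem grMeasure_eq_map {m : ℕ} (T : Euc m ≃ₗᵢ[ℝ] V) (X : Gr (Euc m) j) :
    grMeasure V j = (orthHaar m).map
      fun ρ => X.push (T.toLinearIsometry.comp (orthIso m ρ).toLinearIsometry) := by
  have hm : finrank ℝ V = m := by
    simpa using T.toLinearEquiv.finrank_eq.symm
  subst hm
  have hj : j ≤ finrank ℝ V := by
    simpa [X.2] using Submodule.finrank_le X.1
  rw [grMeasure, dif_pos hj]
  obtain ⟨R, hR⟩ := Gr.exists_push_eq (coordGr hj) X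
  set s := (orthIso _).symm (T.trans (stdOrthonormalBasis ℝ V).repr)
  set r := (orthIso _).symm R
  have hmeas : Measurable (Gr.ofOrth (V := V) hj) := by
    have : Gr.ofOrth (V := V) hj = _ := funext (Gr.ofOrth_eq_push hj)
    rw [this]
    exact ((continuous_push_comp_orthIso _).comp (continuous_id.prodMk continuous_const)).measurable
  have hmul : (orthHaar (finrank ℝ V)).map (fun ρ => s * ρ * r) = orthHaar (finrank ℝ V) :=
    ((measurePreserving_mul_right _ r).comp (measurePreserving_mul_left _ s)).map_eq
  conv_lhs => rw [← hmul]
  rw [Measure.map_map hmeas (by fun_prop)]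
  congr 1
  ext1 ρ
  rw [Function.comp_apply, Gr.ofOrth_eq_push, ← hR, Gr.push_push]
  congr 1
  ext x
  simp [s, r]

theorem grMeasure_map_push {V V' : Type*} [NormedAddCommGroup V] [InnerProductSpace ℝ V]
    [FiniteDimensional ℝ V] [NormedAddCommGroup V'] [InnerProductSpace ℝ V']
    [FiniteDimensional ℝ V'] (hj : j ≤ finrank ℝ V) (T : V ≃ₗᵢ[ℝ] V') :
    (grMeasure V j).map (Gr.push T.toLinearIsometry) = grMeasure V' j := by
  set T0 := (stdOrthonormalBasis ℝ V).repr.symm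
  rw [grMeasure_eq_map T0 (coordGr hj), grMeasure_eq_map (T0.trans T) (coordGr hj),
    Measure.map_map (Gr.continuous_push _).measurable]
  · congr 1
    ext1 ρ
    rw [Function.comp_apply, Gr.push_push]
    rfl
  · exact ((continuous_push_comp_orthIso _).comp
      (continuous_id.prodMk continuous_const)).measurable

theorem isProbabilityMeasure_grMeasure (hj : j ≤ finrank ℝ V) :
    IsProbabilityMeasure (grMeasure V j) := by
  rw [grMeasure_eq_map (stdOrthonormalBasis ℝ V).repr.symm (coordGr hj)]
  exact Measure.isProbabilityMeasure_map ((continuous_push_comp_orthIso _).comp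
      (continuous_id.prodMk continuous_const)).aemeasurable

theorem lintegral_grMeasure_eq_of_const (hj : j ≤ finrank ℝ V) {H : Gr V j → ℝ≥0∞} {c : ℝ≥0∞}
    (hH : ∀ ξ, H ξ = c) : ∫⁻ ξ, H ξ ∂(grMeasure V j) = c := by
  have := isProbabilityMeasure_grMeasure (V := V) hj
  simp [hH]

end Gr

/-! ### Lebesgue measure on subspaces: isometries and orthogonal splitting -/

section Volume

variable {V V' : Type*} [NormedAddCommGroup V] [InnerProductSpace ℝ V] [FiniteDimensional ℝ V]
  [MeasurableSpace V] [BorelSpace V]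
  [NormedAddCommGroup V'] [InnerProductSpace ℝ V'] [FiniteDimensional ℝ V']
  [MeasurableSpace V'] [BorelSpace V']

theorem lintegral_isometry (T : V ≃ₗᵢ[ℝ] V') (G : V' → ℝ≥0∞) :
    ∫⁻ x, G (T x) = ∫⁻ y, G y :=
  T.measurePreserving.lintegral_comp_emb T.toMeasurableEquiv.measurableEmbedding G

theorem lintegral_submodule_eq {X Y : Submodule ℝ V} (h : X = Y) (G : V → ℝ≥0∞) :
    ∫⁻ x : X, G x = ∫⁻ y : Y, G y := by
  subst h; rfl

theorem lintegral_submodule_map (T : V ≃ₗᵢ[ℝ] V') (X : Submodule ℝ V) (G : V' → ℝ≥0∞) :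
    ∫⁻ y : X.map T.toLinearIsometry.toLinearMap, G y = ∫⁻ x : X, G (T x) := by
  exact (lintegral_isometry (T.submoduleMap X) (fun y => G y)).symm

theorem lintegral_orthogonal_decomposition (X : Submodule ℝ V) {G : V → ℝ≥0∞}
    (hG : Measurable G) :
    ∫⁻ x, G x = ∫⁻ x : X, ∫⁻ y : Xᗮ, G (x + y) := by
  rw [← lintegral_prod (f := fun p : X × Xᗮ => G (p.1 + p.2)) (by fun_prop),
    ← lintegral_isometry X.orthogonalDecomposition.symm, 
    ← (WithLp.volume_preserving_toLp X Xᗮ).lintegral_comp_emb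
      (MeasurableEquiv.toLp 2 (X × Xᗮ)).measurableEmbedding]
  rfl

theorem map_orthogonal_isometry (T : V ≃ₗᵢ[ℝ] V') (X : Submodule ℝ V) :
    (X.map T.toLinearIsometry.toLinearMap)ᗮ = Xᗮ.map T.toLinearIsometry.toLinearMap :=
  (Submodule.map_orthogonal_equiv X T).symm

end Volume

/-! ### Gaussian and Gamma integrals -/

/-- The Bochner integral of a non-integrable function is `0`, so a nonzero value already proves
integrability. -/
theorem lintegral_ofReal_of_integral_ne_zero {α : Type*} [MeasurableSpace α] {μ : Measure α}
    {f : α → ℝ} (hf : 0 ≤ᵐ[μ] f) (h : ∫ x, f x ∂μ ≠ 0) :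
    ∫⁻ x, ENNReal.ofReal (f x) ∂μ = ENNReal.ofReal (∫ x, f x ∂μ) :=
  (ofReal_integral_eq_lintegral_ofReal (Integrable.of_integral_ne_zero h) hf).symm

theorem lintegral_rpow_mul_exp_neg {a r : ℝ} (ha : 0 < a) (hr : 0 < r) :
    ∫⁻ t in Set.Ioi (0 : ℝ), ENNReal.ofReal (t ^ (a - 1) * Real.exp (-(r * t))) =
      ENNReal.ofReal (Real.Gamma a * r ^ (-a)) := by
  have h := Real.integral_rpow_mul_exp_neg_mul_Ioi ha hr
  have hpos := Real.Gamma_pos_of_pos ha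
  rw [lintegral_ofReal_of_integral_ne_zero, h]
  · rw [one_div, Real.inv_rpow hr.le, Real.rpow_neg hr.le, mul_comm]
  · filter_upwards [ae_restrict_mem measurableSet_Ioi] with t ht
    have : (0 : ℝ) < t := ht
    simp only [Pi.zero_apply]; positivity
  · rw [h]; positivity

section Euclid

variable {V : Type*} [NormedAddCommGroup V] [InnerProductSpace ℝ V] [FiniteDimensional ℝ V]
  [MeasurableSpace V] [BorelSpace V]

theorem lintegral_gaussian {t : ℝ} (ht : 0 < t) :
    ∫⁻ x : V, ENNReal.ofReal (Real.exp (-(t * ‖x‖ ^ 2))) =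
      ENNReal.ofReal ((Real.pi / t) ^ ((finrank ℝ V : ℝ) / 2)) := by
  have h := GaussianFourier.integral_rexp_neg_mul_sq_norm (V := V) ht
  simp only [neg_mul] at h
  rw [lintegral_ofReal_of_integral_ne_zero, h]
  · exact Filter.Eventually.of_forall fun x => (Real.exp_pos _).le
  · rw [h]; have := Real.pi_pos; positivity

/-- Write `Γ(p) A ^ (-p)` as the integral of `t ^ (p - 1) e ^ (-A t)` over `t > 0` with `A = ‖x‖² +
a`, and apply Tonelli: the integral in `x` becomes Gaussian and the one in `t` is again a Gamma
integral. -/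
theorem lintegral_rpow_neg_norm_sq_add {a p : ℝ} (ha : 0 < a) (hp : (finrank ℝ V : ℝ) / 2 < p) :
    ∫⁻ x : V, ENNReal.ofReal ((‖x‖ ^ 2 + a) ^ (-p)) =
      ENNReal.ofReal (Real.pi ^ ((finrank ℝ V : ℝ) / 2) *
        Real.Gamma (p - (finrank ℝ V : ℝ) / 2) / Real.Gamma p *
          a ^ ((finrank ℝ V : ℝ) / 2 - p)) := by
  set d : ℝ := (finrank ℝ V : ℝ) / 2
  have hd : 0 ≤ d := by positivity
  have hp0 : 0 < p := hd.trans_lt hp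
  have hΓ := Real.Gamma_pos_of_pos hp0
  have hΓ' := Real.Gamma_pos_of_pos (sub_pos.2 hp)
  have h1 : ENNReal.ofReal (Real.Gamma p) * ∫⁻ x : V, ENNReal.ofReal ((‖x‖ ^ 2 + a) ^ (-p)) =
      ENNReal.ofReal (Real.pi ^ d * Real.Gamma (p - d) * a ^ (d - p)) := by
    calc _ = ∫⁻ x : V, ∫⁻ t in Set.Ioi (0 : ℝ),
          ENNReal.ofReal (t ^ (p - 1) * Real.exp (-((‖x‖ ^ 2 + a) * t))) := by
          rw [← lintegral_const_mul _ (by fun_prop)]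
          refine lintegral_congr fun x => ?_
          rw [lintegral_rpow_mul_exp_neg hp0 (by positivity), ENNReal.ofReal_mul hΓ.le]
      _ = ∫⁻ t in Set.Ioi (0 : ℝ), ∫⁻ x : V,
          ENNReal.ofReal (t ^ (p - 1) * Real.exp (-((‖x‖ ^ 2 + a) * t))) :=
          lintegral_lintegral_swap (by fun_prop)
      _ = ∫⁻ t in Set.Ioi (0 : ℝ), ENNReal.ofReal (Real.pi ^ d) *
          ENNReal.ofReal (t ^ (p - d - 1) * Real.exp (-(a * t))) := by
          refine setLIntegral_congr_fun measurableSet_Ioi fun t ht => ?_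
          have ht : 0 < t := ht
          have h2 : ∀ x : V, ENNReal.ofReal (t ^ (p - 1) * Real.exp (-((‖x‖ ^ 2 + a) * t))) =
              ENNReal.ofReal (t ^ (p - 1) * Real.exp (-(a * t))) *
                ENNReal.ofReal (Real.exp (-(t * ‖x‖ ^ 2))) := fun x => by
            rw [← ENNReal.ofReal_mul (by positivity), mul_assoc, ← Real.exp_add]
            ring_nf
          simp only [h2]
          rw [lintegral_const_mul _ (by fun_prop), lintegral_gaussian ht,
            ← ENNReal.ofReal_mul (by positivity), ← ENNReal.ofReal_mul (by positivity),
            Real.div_rpow Real.pi_pos.le ht.le, show p - d - 1 = p - 1 - d by ring,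
            Real.rpow_sub ht (p - 1) d]
          congr 1
          change _ * (Real.pi ^ d / t ^ d) = _
          ring
      _ = _ := by
          rw [lintegral_const_mul _ (by fun_prop), lintegral_rpow_mul_exp_neg (sub_pos.2 hp) ha,
            ← ENNReal.ofReal_mul (by positivity), neg_sub, mul_assoc]
  have h3 : ENNReal.ofReal (Real.Gamma p) ≠ 0 := by simpa using hΓ
  rw [← ENNReal.mul_right_inj h3 ENNReal.ofReal_ne_top, h1, ← ENNReal.ofReal_mul hΓ.le]
  congr 1
  field_simp

/-- Polar coordinates. -/
theorem lintegral_fun_norm [Nontrivial V] {f : ℝ → ℝ≥0∞} (hf : Measurable f) :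
    ∫⁻ x : V, f ‖x‖ = (volume : Measure V).toSphere Set.univ *
      ∫⁻ r in Set.Ioi (0 : ℝ), ENNReal.ofReal (r ^ (finrank ℝ V - 1)) * f r := by
  have h1 : ∫⁻ x : V, f ‖x‖ = ∫⁻ x : ({(0 : V)}ᶜ : Set V), f ‖x.1‖
      ∂((volume : Measure V).comap (↑)) := by
    rw [lintegral_subtype_comap (measurableSet_singleton _).compl (fun x : V => f ‖x‖),
      restrict_compl_singleton]
  have h2 := (Measure.measurePreserving_homeomorphUnitSphereProd
    (volume : Measure V)).lintegral_comp_emb (Homeomorph.measurableEmbedding _)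
      (fun p => f p.2)
  simp only [homeomorphUnitSphereProd_apply_snd_coe] at h2
  rw [h1, h2, lintegral_prod _ (by fun_prop)]
  dsimp only
  rw [lintegral_const, mul_comm]
  congr 1
  rw [Measure.volumeIoiPow, lintegral_withDensity_eq_lintegral_mul _ (by fun_prop) (by fun_prop),
    ← lintegral_subtype_comap measurableSet_Ioi]
  rfl

theorem lintegral_norm_rpow_mul_gaussian {s : ℝ} [Nontrivial V] (hs : s < finrank ℝ V) :
    ∫⁻ x : V, ENNReal.ofReal (‖x‖ ^ (-s)) * ENNReal.ofReal (Real.exp (-‖x‖ ^ 2)) =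
      ENNReal.ofReal (Real.pi ^ ((finrank ℝ V : ℝ) / 2) *
        Real.Gamma (((finrank ℝ V : ℝ) - s) / 2) / Real.Gamma ((finrank ℝ V : ℝ) / 2)) := by
  have hd : 0 < finrank ℝ V := finrank_pos
  set d := finrank ℝ V with hdd
  have key : ∀ s : ℝ, s < d → ∫⁻ x : V, ENNReal.ofReal (‖x‖ ^ (-s)) *
      ENNReal.ofReal (Real.exp (-‖x‖ ^ 2)) = (volume : Measure V).toSphere Set.univ *
        ENNReal.ofReal (1 / 2 * Real.Gamma ((d - s) / 2)) := by
    intro s hs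
    rw [lintegral_fun_norm (V := V) (f := fun r => ENNReal.ofReal (r ^ (-s)) *
      ENNReal.ofReal (Real.exp (-r ^ 2))) (by fun_prop)]
    congr 1
    have h := integral_rpow_mul_exp_neg_rpow (p := 2) (q := d - 1 - s) two_pos (by linarith)
    rw [show (d - 1 - s + 1 : ℝ) = d - s by ring] at h
    have hpos : 0 < Real.Gamma ((d - s) / 2) := Real.Gamma_pos_of_pos (by linarith)
    rw [← h, ← lintegral_ofReal_of_integral_ne_zero]
    · refine setLIntegral_congr_fun measurableSet_Ioi fun r hr => ?_
      have hr : 0 < r := hr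
      change ENNReal.ofReal (r ^ (d - 1)) * _ = _
      rw [← mul_assoc, ← ENNReal.ofReal_mul (by positivity), ← ENNReal.ofReal_mul (by positivity),
        ← Real.rpow_natCast, ← Real.rpow_add hr, Nat.cast_pred hd]
      simp [sub_eq_add_neg]
    · filter_upwards [ae_restrict_mem measurableSet_Ioi] with t ht
      have : (0 : ℝ) < t := ht
      simp only [Pi.zero_apply]; positivity
    · rw [h]; positivity
  have h0 := key 0 (by positivity)
  have hg := lintegral_gaussian (V := V) one_pos
  simp only [neg_zero, Real.rpow_zero, ENNReal.ofReal_one, one_mul, sub_zero, div_one,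
    ← hdd] at h0 hg
  rw [hg] at h0
  have hΓ : 0 < Real.Gamma ((d : ℝ) / 2) := Real.Gamma_pos_of_pos (by positivity)
  -- The area of the sphere is read off from the case `s = 0`, where the integral is the known
  -- Gaussian one.
  have hC : (volume : Measure V).toSphere Set.univ =
      ENNReal.ofReal (2 * Real.pi ^ ((d : ℝ) / 2) / Real.Gamma ((d : ℝ) / 2)) := by
    have h3 : ENNReal.ofReal (1 / 2 * Real.Gamma ((d : ℝ) / 2)) ≠ 0 := by
      simpa using hΓ
    rw [← ENNReal.mul_left_inj h3 ENNReal.ofReal_ne_top, ← h0,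
      ← ENNReal.ofReal_mul (by have := Real.pi_pos; positivity)]
    congr 1
    field_simp
  rw [key s hs, hC, ← ENNReal.ofReal_mul (by have := Real.pi_pos; positivity)]
  congr 1
  field_simp

end Euclid

/-! ### Means over the Grassmannian -/

section Means

variable {V : Type*} [NormedAddCommGroup V] [InnerProductSpace ℝ V] [FiniteDimensional ℝ V]
  {k : ℕ}

theorem Gr.continuous_starProjection_apply :
    Continuous fun p : Gr V k × V => p.1.1.starProjection p.2 := by
  have h : Continuous fun ξ : Gr V k => (ξ.1.starProjection : V →L[ℝ] V) := continuous_induced_dom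
  exact (h.comp continuous_fst).clm_apply continuous_snd

theorem Gr.continuous_norm_sub_starProjection :
    Continuous fun p : Gr V k × V => ‖p.2 - p.1.1.starProjection p.2‖ :=
  (continuous_snd.sub Gr.continuous_starProjection_apply).norm

theorem Gr.measurable_norm_sub_starProjection (x : V) :
    Measurable fun Y : Gr V k => ‖x - Y.1.starProjection x‖ :=
  (Gr.continuous_norm_sub_starProjection.comp (continuous_id.prodMk continuous_const)).measurable

theorem norm_sub_starProjection_smul (Y : Submodule ℝ V) (r : ℝ) (x : V) :
    ‖r • x - Y.starProjection (r • x)‖ = |r| * ‖x - Y.starProjection x‖ := by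
  rw [map_smul, ← smul_sub, norm_smul, Real.norm_eq_abs]

theorem lintegral_grMeasure_norm_sub_isometry (hk : k ≤ finrank ℝ V) {G : ℝ → ℝ≥0∞}
    (hG : Measurable G) (T : V ≃ₗᵢ[ℝ] V) (x : V) :
    ∫⁻ Y : Gr V k, G ‖T x - Y.1.starProjection (T x)‖ ∂(grMeasure V k) =
      ∫⁻ Y : Gr V k, G ‖x - Y.1.starProjection x‖ ∂(grMeasure V k) := by
  have hm : Measurable fun Y : Gr V k => G ‖T x - Y.1.starProjection (T x)‖ :=
    hG.comp (Gr.measurable_norm_sub_starProjection _)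
  have h := lintegral_map hm (Gr.continuous_push (j := k) T.toLinearIsometry).measurable
    (μ := grMeasure V k)
  rw [grMeasure_map_push hk T] at h
  rw [h]
  refine lintegral_congr fun Y => ?_
  congr 1
  have h := T.toLinearIsometry.map_starProjection Y.1 x
  change ‖T x - (Y.1.map T.toLinearIsometry.toLinearMap).starProjection (T x)‖ = _
  rw [← T.norm_map (x - Y.1.starProjection x), map_sub]
  exact congrArg (fun z => ‖T x - z‖) h.symm

/-- By rotation invariance the mean depends only on `‖x‖`, so `x` may be replaced by `‖x‖ • e`. -/
theorem lintegral_grMeasure_norm_sub_radial (hk : k ≤ finrank ℝ V) {G : ℝ → ℝ≥0∞}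
    (hG : Measurable G) {e : V} (he : ‖e‖ = 1) (x : V) :
    ∫⁻ Y : Gr V k, G ‖x - Y.1.starProjection x‖ ∂(grMeasure V k) =
      ∫⁻ Y : Gr V k, G (‖x‖ * ‖e - Y.1.starProjection e‖) ∂(grMeasure V k) := by
  obtain ⟨T, hT⟩ := exists_isometry_apply (x := ‖x‖ • e) (y := x) (by simp [norm_smul, he])
  have h := lintegral_grMeasure_norm_sub_isometry hk hG T (‖x‖ • e)
  rw [hT] at h
  simpa only [norm_sub_starProjection_smul, abs_norm] using h

variable [MeasurableSpace V] [BorelSpace V]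

/-- After Tonelli, fix `Y` and split `x = y + z` along `Y ⊕ Yᗮ`. Then `‖x‖² = ‖y‖² + ‖z‖²` and `x -
P_Y x = z`, so hypothesis `hFGH` separates the variables, and the product `a * b` is the same for
all `Y`. This evaluates one side of each Gaussian double integral below. -/
theorem lintegral_lintegral_grMeasure_split (hk : k ≤ finrank ℝ V)
    {G H : ℝ → ℝ≥0∞} (hG : Measurable G) (hH : Measurable H) {a b : ℝ≥0∞}
    (ha : ∀ Y : Gr V k, ∫⁻ y : Y.1, G ‖y‖ = a) (hb : ∀ Y : Gr V k, ∫⁻ y : Y.1ᗮ, H ‖y‖ = b)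
    {F : ℝ → ℝ → ℝ≥0∞} (hF : Measurable (Function.uncurry F))
    (hFGH : ∀ r s : ℝ, F (Real.sqrt (r ^ 2 + s ^ 2)) s = G r * H s) :
    ∫⁻ x : V, ∫⁻ Y : Gr V k, F ‖x‖ ‖x - Y.1.starProjection x‖ ∂(grMeasure V k) = a * b := by
  have := isProbabilityMeasure_grMeasure hk
  have hm : Measurable fun p : V × Gr V k => F ‖p.1‖ ‖p.1 - p.2.1.starProjection p.1‖ :=
    hF.comp ((measurable_fst.norm).prodMk
      (Gr.continuous_norm_sub_starProjection.comp continuous_swap).measurable)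
  rw [lintegral_lintegral_swap hm.aemeasurable]
  refine lintegral_grMeasure_eq_of_const hk fun Y => ?_
  rw [lintegral_orthogonal_decomposition Y.1 (by
    exact hm.comp (measurable_id.prodMk measurable_const))]
  have h : ∀ (y : Y.1) (z : Y.1ᗮ),
      F ‖(y : V) + z‖ ‖(y : V) + z - Y.1.starProjection ((y : V) + z)‖ = G ‖y‖ * H ‖z‖ := by
    intro y z
    have h1 : Y.1.starProjection ((y : V) + z) = y := by
      rw [map_add, Submodule.starProjection_eq_self_iff.2 y.2,
        (Submodule.starProjection_apply_eq_zero_iff _).2 z.2, add_zero]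
    have h2 : ‖(y : V) + z‖ = Real.sqrt (‖y‖ ^ 2 + ‖z‖ ^ 2) := by
      rw [← Real.sqrt_sq (norm_nonneg ((y : V) + z)), sq, sq, sq,
        norm_add_mul_self_real, z.2 _ y.2]
      simp
    rw [h1, h2, add_sub_cancel_left]
    exact hFGH _ _
  simp only [h]
  have hH' : Measurable fun z : Y.1ᗮ => H ‖z‖ := hH.comp measurable_norm
  have hG' : Measurable fun z : Y.1 => G ‖z‖ := hG.comp measurable_norm
  simp only [lintegral_const_mul _ hH', hb, lintegral_mul_const _ hG', ha]

theorem Gr.finrank_orthogonal (Y : Gr V k) :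
    (finrank ℝ Y.1ᗮ : ℝ) = (finrank ℝ V : ℝ) - k := by
  have := Y.1.finrank_add_finrank_orthogonal
  rw [Y.2] at this
  rw [← this]; push_cast; ring

/-- The mean of `|pr_{Yᗮ} x| ^ (-s)` over all `k`-dimensional subspaces `Y`. -/
theorem lintegral_grMeasure_norm_rpow (hk : k < finrank ℝ V) {s : ℝ}
    (hs : s < (finrank ℝ V : ℝ) - k) (x : V) :
    ∫⁻ Y : Gr V k, ENNReal.ofReal (‖x - Y.1.starProjection x‖ ^ (-s)) ∂(grMeasure V k) =
      ENNReal.ofReal (Real.Gamma (((finrank ℝ V : ℝ) - k - s) / 2) *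
        Real.Gamma ((finrank ℝ V : ℝ) / 2) / (Real.Gamma (((finrank ℝ V : ℝ) - k) / 2) *
          Real.Gamma (((finrank ℝ V : ℝ) - s) / 2))) * ENNReal.ofReal (‖x‖ ^ (-s)) := by
  have : Nontrivial V := Module.nontrivial_of_finrank_pos (R := ℝ) (by omega)
  obtain ⟨e, he⟩ := exists_norm_eq V (zero_le_one (α := ℝ))
  set m : ℝ := (finrank ℝ V : ℝ) with hm
  have hkm : (k : ℝ) < m := by rw [hm]; exact_mod_cast hk
  have hk0 : (0 : ℝ) ≤ k := by positivity
  set A := ∫⁻ Y : Gr V k, ENNReal.ofReal (‖e - Y.1.starProjection e‖ ^ (-s)) ∂(grMeasure V k)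
  -- By rotation invariance and homogeneity the mean is a constant multiple of `‖x‖ ^ (-s)`; only
  -- the constant `A` remains to be found.
  have hA : ∀ x : V, ∫⁻ Y : Gr V k, ENNReal.ofReal (‖x - Y.1.starProjection x‖ ^ (-s))
      ∂(grMeasure V k) = ENNReal.ofReal (‖x‖ ^ (-s)) * A := by
    intro x
    rw [lintegral_grMeasure_norm_sub_radial hk.le
      (G := fun r => ENNReal.ofReal (r ^ (-s))) (by fun_prop) he x,
      ← lintegral_const_mul _ (by
        have := Gr.measurable_norm_sub_starProjection (k := k) e
        fun_prop)]
    refine lintegral_congr fun Y => ?_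
    rw [Real.mul_rpow (norm_nonneg _) (norm_nonneg _), ENNReal.ofReal_mul (by positivity)]
  have hΓ1 : 0 < Real.Gamma ((m - k) / 2) := Real.Gamma_pos_of_pos (by linarith)
  have hΓ2 : 0 < Real.Gamma ((m - s) / 2) := Real.Gamma_pos_of_pos (by linarith)
  have hΓ3 : 0 < Real.Gamma (m / 2) := Real.Gamma_pos_of_pos (by linarith)
  have hΓ4 : 0 < Real.Gamma ((m - k - s) / 2) := Real.Gamma_pos_of_pos (by linarith)
  have hπ := Real.pi_pos
  -- The mean is integrated against `exp (-‖x‖²)`. Splitting along `Y ⊕ Yᗮ` gives an explicit value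
  -- here; integrating over `Y` first, in `h2`, gives a known multiple of `A`.
  have h1 := lintegral_lintegral_grMeasure_split (V := V) (k := k) hk.le
    (G := fun r => ENNReal.ofReal (Real.exp (-(1 * r ^ 2))))
    (H := fun r => ENNReal.ofReal (r ^ (-s)) * ENNReal.ofReal (Real.exp (-r ^ 2)))
    (F := fun r u => ENNReal.ofReal (Real.exp (-r ^ 2)) * ENNReal.ofReal (u ^ (-s)))
    (a := ENNReal.ofReal (Real.pi ^ ((k : ℝ) / 2)))
    (b := ENNReal.ofReal (Real.pi ^ ((m - k) / 2) * Real.Gamma ((m - k - s) / 2) /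
      Real.Gamma ((m - k) / 2)))
    (by fun_prop) (by fun_prop)
    (fun Y => by rw [lintegral_gaussian one_pos, Y.2, div_one])
    (fun Y => by
      have hf := Y.finrank_orthogonal
      have : Nontrivial Y.1ᗮ := Module.nontrivial_of_finrank_pos (R := ℝ) (by
        have : (0 : ℝ) < finrank ℝ Y.1ᗮ := by rw [hf]; linarith
        exact_mod_cast this)
      rw [lintegral_norm_rpow_mul_gaussian (by rw [hf]; exact hs), hf])
    (by fun_prop)
    (fun r u => by
      rw [Real.sq_sqrt (by positivity), neg_add, Real.exp_add, ENNReal.ofReal_mul (by positivity),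
        one_mul]
      ring)
  have h2 : ∫⁻ x : V, ∫⁻ Y : Gr V k, ENNReal.ofReal (Real.exp (-‖x‖ ^ 2)) *
      ENNReal.ofReal (‖x - Y.1.starProjection x‖ ^ (-s)) ∂(grMeasure V k) =
      ENNReal.ofReal (Real.pi ^ (m / 2) * Real.Gamma ((m - s) / 2) / Real.Gamma (m / 2)) * A := by
    rw [← lintegral_norm_rpow_mul_gaussian (V := V) (by linarith),
      ← lintegral_mul_const _ (by fun_prop)]
    refine lintegral_congr fun x => ?_
    rw [lintegral_const_mul _ (by
      have := Gr.measurable_norm_sub_starProjection (k := k) x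
      fun_prop), hA]
    ring
  rw [hA, mul_comm]
  congr 1
  have h3 : ENNReal.ofReal (Real.pi ^ (m / 2) * Real.Gamma ((m - s) / 2) / Real.Gamma (m / 2)) ≠ 0 := by
    simp only [ne_eq, ENNReal.ofReal_eq_zero, not_le]; positivity
  rw [← ENNReal.mul_right_inj h3 ENNReal.ofReal_ne_top, ← h2, h1, 
    ← ENNReal.ofReal_mul (by positivity), ← ENNReal.ofReal_mul (by positivity)]
  congr 1
  rw [show m / 2 = (k : ℝ) / 2 + (m - k) / 2 by ring, Real.rpow_add hπ]
  rw [show (k : ℝ) / 2 + (m - k) / 2 = m / 2 by ring]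
  field_simp

/-- The mean of `(1 + |pr_{Yᗮ} x| ^ 2) ^ (- dim V / 2)` over all `k`-dimensional subspaces `Y`. -/
theorem lintegral_grMeasure_one_add_norm_rpow (hk : k < finrank ℝ V) (x : V) :
    ∫⁻ Y : Gr V k, ENNReal.ofReal ((1 + ‖x - Y.1.starProjection x‖ ^ 2) ^
        (-((finrank ℝ V : ℝ) / 2))) ∂(grMeasure V k) =
      ENNReal.ofReal ((1 + ‖x‖ ^ 2) ^ (-(((finrank ℝ V : ℝ) - k) / 2))) := by
  have : Nontrivial V := Module.nontrivial_of_finrank_pos (R := ℝ) (by omega)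
  have := isProbabilityMeasure_grMeasure hk.le
  obtain ⟨e, he⟩ := exists_norm_eq V (zero_le_one (α := ℝ))
  set m : ℝ := (finrank ℝ V : ℝ) with hm
  set R := ‖x‖
  have hπ := Real.pi_pos
  have he' := Gr.measurable_norm_sub_starProjection (k := k) e
  -- With `R = ‖x‖` fixed, the function `exp (-(‖y‖² + R² ‖y - P_Y y‖²))` of a new variable `y` is
  -- integrated in two ways. For fixed `Y` it splits into Gaussians on `Y` and `Yᗮ`. In `h2`, `y` is
  -- rotated to `‖y‖ • e` and integrated first, which produces the power `-m / 2` and hence `π ^ (m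
  -- / 2)` times the wanted mean.
  have h1 := lintegral_lintegral_grMeasure_split (V := V) (k := k) hk.le
    (G := fun r => ENNReal.ofReal (Real.exp (-(1 * r ^ 2))))
    (H := fun r => ENNReal.ofReal (Real.exp (-((1 + R ^ 2) * r ^ 2))))
    (F := fun r u => ENNReal.ofReal (Real.exp (-(r ^ 2 + R ^ 2 * u ^ 2))))
    (a := ENNReal.ofReal (Real.pi ^ ((k : ℝ) / 2)))
    (b := ENNReal.ofReal ((Real.pi / (1 + R ^ 2)) ^ ((m - k) / 2)))
    (by fun_prop) (by fun_prop)
    (fun Y => by rw [lintegral_gaussian one_pos, Y.2, div_one])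
    (fun Y => by rw [lintegral_gaussian (by positivity), Y.finrank_orthogonal])
    (by unfold Function.uncurry; fun_prop)
    (fun r u => by
      rw [Real.sq_sqrt (by positivity), ← ENNReal.ofReal_mul (by positivity), ← Real.exp_add]
      ring_nf)
  have h2 : ∫⁻ x : V, ∫⁻ Y : Gr V k, ENNReal.ofReal (Real.exp (-(‖x‖ ^ 2 + R ^ 2 *
      ‖x - Y.1.starProjection x‖ ^ 2))) ∂(grMeasure V k) =
      ENNReal.ofReal (Real.pi ^ (m / 2)) * ∫⁻ Y : Gr V k, ENNReal.ofReal
        ((1 + (R * ‖e - Y.1.starProjection e‖) ^ 2) ^ (-(m / 2))) ∂(grMeasure V k) := by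
    calc _ = ∫⁻ x : V, ∫⁻ Y : Gr V k, ENNReal.ofReal (Real.exp
          (-((1 + (R * ‖e - Y.1.starProjection e‖) ^ 2) * ‖x‖ ^ 2))) ∂(grMeasure V k) := by
          refine lintegral_congr fun x => ?_
          rw [lintegral_grMeasure_norm_sub_radial hk.le (G := fun u => ENNReal.ofReal
            (Real.exp (-(‖x‖ ^ 2 + R ^ 2 * u ^ 2)))) (by fun_prop) he x]
          refine lintegral_congr fun Y => ?_
          ring_nf
      _ = ∫⁻ Y : Gr V k, (∫⁻ x : V, ENNReal.ofReal (Real.exp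
          (-((1 + (R * ‖e - Y.1.starProjection e‖) ^ 2) * ‖x‖ ^ 2)))) ∂(grMeasure V k) := by
          refine lintegral_lintegral_swap ?_
          have : Measurable fun p : V × Gr V k => ‖e - p.2.1.starProjection e‖ :=
            he'.comp measurable_snd
          unfold Function.uncurry
          fun_prop
      _ = _ := by
          have hmY : Measurable fun Y : Gr V k => ENNReal.ofReal
              ((1 + (R * ‖e - Y.1.starProjection e‖) ^ 2) ^ (-(m / 2))) := by fun_prop
          rw [← lintegral_const_mul _ hmY]
          refine lintegral_congr fun Y => ?_
          rw [lintegral_gaussian (by positivity), Real.div_rpow hπ.le (by positivity),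
            ← ENNReal.ofReal_mul (by positivity), Real.rpow_neg (by positivity)]
          rfl
  rw [lintegral_grMeasure_norm_sub_radial hk.le (G := fun u => ENNReal.ofReal
    ((1 + u ^ 2) ^ (-(m / 2)))) (by fun_prop) he x]
  have h3 : ENNReal.ofReal (Real.pi ^ (m / 2)) ≠ 0 := by
    simp only [ne_eq, ENNReal.ofReal_eq_zero, not_le]; positivity
  rw [← ENNReal.mul_right_inj h3 ENNReal.ofReal_ne_top]
  refine h2.symm.trans (h1.trans ?_)
  rw [← ENNReal.ofReal_mul (by positivity), ← ENNReal.ofReal_mul (by positivity)]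
  congr 1
  rw [Real.div_rpow hπ.le (by positivity), Real.rpow_neg (by positivity),
    show m / 2 = (k : ℝ) / 2 + (m - k) / 2 by ring, Real.rpow_add hπ]
  field_simp

end Means

/-! ### The affine Grassmannian -/

variable {n j k : ℕ}

theorem AffGr.foot_eq_iff (τ : AffGr n j) (x : Euc n) :
    τ.foot = x ↔ x ∈ τ.1 ∧ x ∈ τ.1.directionᗮ := by
  have : Nonempty τ.1 := τ.2.1.to_subtype
  rw [AffGr.foot, EuclideanGeometry.coe_orthogonalProjection_eq_iff_mem]
  simp

theorem AffGr.foot_mem (τ : AffGr n j) : τ.foot ∈ τ.1 :=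
  ((τ.foot_eq_iff _).1 rfl).1

theorem AffGr.foot_mem_orthogonal (τ : AffGr n j) : τ.foot ∈ τ.1.directionᗮ :=
  ((τ.foot_eq_iff _).1 rfl).2

theorem AffGr.dist0_eq_norm_foot (τ : AffGr n j) : τ.dist0 = ‖τ.foot‖ := by
  have : Nonempty τ.1 := τ.2.1.to_subtype
  have h := EuclideanGeometry.dist_orthogonalProjection_eq_infDist τ.1 0
  rw [AffGr.dist0, ← h, AffGr.foot, dist_zero_left]

theorem Gr.direction_shift (ξ : Gr (Euc n) j) (x : Euc n) : (ξ.shift x).1.direction = ξ.1 :=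
  AffineSubspace.direction_mk' x ξ.1

theorem Gr.foot_shift (ξ : Gr (Euc n) j) (x : Euc n) :
    (ξ.shift x).foot = x - ξ.1.starProjection x := by
  rw [AffGr.foot_eq_iff, Gr.direction_shift]
  refine ⟨?_, Submodule.sub_starProjection_mem_orthogonal x⟩
  change _ ∈ AffineSubspace.mk' x ξ.1
  rw [AffineSubspace.mem_mk']
  simp [Submodule.starProjection_apply_mem]

theorem Gr.dist0_shift (ξ : Gr (Euc n) j) (x : Euc n) :
    (ξ.shift x).dist0 = ‖x - ξ.1.starProjection x‖ := by
  rw [AffGr.dist0_eq_norm_foot, Gr.foot_shift]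

theorem Gr.shift_eq_shift_iff (ξ : Gr (Euc n) j) (x y : Euc n) :
    ξ.shift x = ξ.shift y ↔ x - y ∈ ξ.1 := by
  refine Subtype.ext_iff.trans ?_
  change AffineSubspace.mk' x ξ.1 = AffineSubspace.mk' y ξ.1 ↔ _
  constructor
  · intro h
    have := AffineSubspace.self_mem_mk' x ξ.1
    rw [h, AffineSubspace.mem_mk'] at this
    exact this
  · intro h
    have hx : x ∈ AffineSubspace.mk' y ξ.1 := by rw [AffineSubspace.mem_mk']; exact h
    simpa using AffineSubspace.mk'_eq hx

theorem AffGr.shift_foot (τ : AffGr n j) :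
    Gr.shift ⟨τ.1.direction, τ.2.2⟩ τ.foot = τ :=
  Subtype.ext (AffineSubspace.mk'_eq τ.foot_mem)

theorem AffGr.injective_direction_foot : Function.Injective
    fun τ : AffGr n j => ((τ.1.direction.starProjection : Euc n →L[ℝ] Euc n), τ.foot) := by
  intro τ σ h
  have h1 : (⟨τ.1.direction, τ.2.2⟩ : Gr (Euc n) j) = ⟨σ.1.direction, σ.2.2⟩ :=
    Gr.injective_starProjection (congrArg Prod.fst h)
  have h2 : τ.foot = σ.foot := congrArg Prod.snd h
  rw [← τ.shift_foot, ← σ.shift_foot, h1, h2]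

instance AffGr.instSecondCountableTopology : SecondCountableTopology (AffGr n j) := by
  have : SecondCountableTopology (Euc n →L[ℝ] Euc n) := inferInstance
  exact TopologicalSpace.secondCountableTopology_induced _ _ _

instance AffGr.instT2Space : T2Space (AffGr n j) :=
  T2Space.of_injective_continuous AffGr.injective_direction_foot continuous_induced_dom

theorem AffGr.continuous_foot : Continuous (AffGr.foot : AffGr n j → Euc n) := by
  have h : Continuous fun τ : AffGr n j =>
    ((τ.1.direction.starProjection : Euc n →L[ℝ] Euc n), τ.foot) := continuous_induced_dom
  exact h.snd

theorem AffGr.continuous_dist0 : Continuous (AffGr.dist0 : AffGr n j → ℝ) := by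
  simp only [funext AffGr.dist0_eq_norm_foot]
  exact AffGr.continuous_foot.norm

theorem Gr.continuous_shift : Continuous fun p : Gr (Euc n) j × Euc n => p.1.shift p.2 := by
  refine continuous_induced_rng.2 ?_
  have h : Continuous fun ξ : Gr (Euc n) j => (ξ.1.starProjection : Euc n →L[ℝ] Euc n) :=
    continuous_induced_dom
  refine ((h.comp continuous_fst).prodMk
    (continuous_snd.sub Gr.continuous_starProjection_apply)).congr fun p => ?_
  refine Prod.ext ?_ (Gr.foot_shift _ _).symm
  exact congrArg (fun X : Submodule ℝ (Euc n) => X.starProjection)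
    (Gr.direction_shift p.1 p.2).symm

/-! ### The orthogonal group acting on planes -/

/-- The image of `ξ` under an orthogonal map. -/
abbrev Gr.act (g : OrthGroup n) (ξ : Gr (Euc n) j) : Gr (Euc n) j :=
  ξ.push (orthIso n g).toLinearIsometry

theorem continuous_act : Continuous fun p : OrthGroup n × Gr (Euc n) j => p.2.act p.1 :=
  Gr.continuous_push_of_continuous ((continuous_orthIso n).comp continuous_fst) continuous_snd

theorem continuous_orthIso_apply :
    Continuous fun p : OrthGroup n × Euc n => orthIso n p.1 p.2 :=
  ((continuous_orthIso n).comp continuous_fst).clm_apply continuous_snd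

theorem continuous_act_shift : Continuous fun p : OrthGroup n × Gr (Euc n) j × Euc n =>
    (p.2.1.act p.1).shift (orthIso n p.1 p.2.2) :=
  Gr.continuous_shift.comp
    ((continuous_act.comp (continuous_fst.prodMk continuous_snd.fst)).prodMk
      (continuous_orthIso_apply.comp (continuous_fst.prodMk continuous_snd.snd)))

theorem Gr.act_mul (g h : OrthGroup n) (ξ : Gr (Euc n) j) : ξ.act (g * h) = (ξ.act h).act g := by
  rw [Gr.act, Gr.act, Gr.act, Gr.push_push, map_mul]
  rfl

theorem orthIso_mul_apply (g h : OrthGroup n) (x : Euc n) :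
    orthIso n (g * h) x = orthIso n g (orthIso n h x) := by
  rw [map_mul]; rfl

theorem exists_act_pair {X Y X' Y' : Submodule ℝ (Euc n)} (h : X ⟂ Y) (h' : X' ⟂ Y')
    (hX : finrank ℝ X = finrank ℝ X') (hY : finrank ℝ Y = finrank ℝ Y') :
    ∃ g : OrthGroup n, X.map (orthIso n g).toLinearIsometry.toLinearMap = X' ∧
      Y.map (orthIso n g).toLinearIsometry.toLinearMap = Y' := by
  obtain ⟨T, hT⟩ := exists_isometry_map_pair h h' hX hY
  exact ⟨(orthIso n).symm T, by simpa using hT⟩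

theorem Gr.surjective_act (X : Gr (Euc n) j) : Function.Surjective fun g : OrthGroup n => X.act g := by
  intro ξ
  obtain ⟨T, hT⟩ := Gr.exists_push_eq X ξ
  exact ⟨(orthIso n).symm T, by simpa [Gr.act] using hT⟩

theorem Gr.orthogonal_act (X : Gr (Euc n) j) (g : OrthGroup n) :
    (X.act g).1ᗮ = X.1ᗮ.map (orthIso n g).toLinearIsometry.toLinearMap :=
  map_orthogonal_isometry _ _

theorem lintegral_orthogonal_act (X : Gr (Euc n) j) (g : OrthGroup n) (G : Euc n → ℝ≥0∞) :
    ∫⁻ u : ↥(X.act g).1ᗮ, G u = ∫⁻ u : X.1ᗮ, G (orthIso n g u) := by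
  rw [lintegral_submodule_eq (X.orthogonal_act g), lintegral_submodule_map]

theorem lintegral_orthHaar_mul_right (g : OrthGroup n) (G : OrthGroup n → ℝ≥0∞) :
    ∫⁻ h, G (h * g) ∂(orthHaar n) = ∫⁻ h, G h ∂(orthHaar n) :=
  lintegral_mul_right_eq_self G g

/-! ### The measure on the affine Grassmannian -/

/-- The plane `g (X + u)`. -/
def planeMap (X : Gr (Euc n) j) (p : OrthGroup n × X.1ᗮ) : AffGr n j :=
  (X.act p.1).shift (orthIso n p.1 p.2)

theorem continuous_planeMap (X : Gr (Euc n) j) : Continuous (planeMap X) := by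
  have h : Continuous fun p : OrthGroup n × X.1ᗮ => (p.1, X, (p.2 : Euc n)) :=
    continuous_fst.prodMk (continuous_const.prodMk (continuous_subtype_val.comp continuous_snd))
  have h2 := (continuous_act_shift (n := n) (j := j)).comp h
  exact h2

theorem orthIso_mem_orthogonal_act (X : Gr (Euc n) j) (g : OrthGroup n) (u : X.1ᗮ) :
    orthIso n g u ∈ (X.act g).1ᗮ := by
  rw [Gr.orthogonal_act]
  exact ⟨u, u.2, rfl⟩

theorem foot_planeMap (X : Gr (Euc n) j) (p : OrthGroup n × X.1ᗮ) :
    (planeMap X p).foot = orthIso n p.1 p.2 := by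
  rw [planeMap, Gr.foot_shift, (Submodule.starProjection_apply_eq_zero_iff _).2
    (orthIso_mem_orthogonal_act X p.1 p.2), sub_zero]

theorem dist0_planeMap (X : Gr (Euc n) j) (p : OrthGroup n × X.1ᗮ) :
    (planeMap X p).dist0 = ‖p.2‖ := by
  rw [AffGr.dist0_eq_norm_foot, foot_planeMap, LinearIsometryEquiv.norm_map, Submodule.coe_norm]

theorem surjective_planeMap (X : Gr (Euc n) j) : Function.Surjective (planeMap X) := by
  intro τ
  obtain ⟨g, hg⟩ := X.surjective_act ⟨τ.1.direction, τ.2.2⟩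
  have hg' : X.act g = ⟨τ.1.direction, τ.2.2⟩ := hg
  have h : τ.foot ∈ (X.act g).1ᗮ := by rw [hg']; exact τ.foot_mem_orthogonal
  rw [Gr.orthogonal_act] at h
  obtain ⟨u, hu, huτ⟩ := h
  refine ⟨(g, ⟨u, hu⟩), ?_⟩
  have huτ' : orthIso n g u = τ.foot := huτ
  change (X.act g).shift (orthIso n g u) = τ
  rw [hg', huτ', AffGr.shift_foot]

/-- The direction `gX` has the invariant law when `g` is Haar distributed, and `g` maps `Xᗮ`
isometrically onto `(gX)ᗮ`. This replaces the varying space `ξᗮ` by the fixed space `Xᗮ`, so that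
Tonelli applies on a product. -/
theorem affMeasure_eq_map (X : Gr (Euc n) j) :
    affMeasure n j = ((orthHaar n).prod (volume : Measure X.1ᗮ)).map (planeMap X) := by
  have hact : Measurable fun g : OrthGroup n => X.act g :=
    (continuous_act.comp (continuous_id.prodMk continuous_const)).measurable
  have hshift : ∀ ξ : Gr (Euc n) j, Measurable fun u : ξ.1ᗮ => ξ.shift (u : Euc n) := fun ξ =>
    (Gr.continuous_shift.comp (continuous_const.prodMk continuous_subtype_val)).measurable
  have hX := (continuous_planeMap X).measurable
  have key : ∀ {s : Set (AffGr n j)}, MeasurableSet s → ∀ g : OrthGroup n,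
      (volume : Measure ↥(X.act g).1ᗮ).map (fun u : ↥(X.act g).1ᗮ => (X.act g).shift (u : Euc n)) s
        = ∫⁻ u : X.1ᗮ, s.indicator 1 (planeMap X (g, u)) := by
    intro s hs g
    rw [← lintegral_indicator_one hs, lintegral_map (measurable_one.indicator hs) (hshift _),
      lintegral_orthogonal_act X g fun u => s.indicator 1 ((X.act g).shift u)]
    rfl
  have hmeas : Measurable fun ξ : Gr (Euc n) j =>
      (volume : Measure ↥(ξ.1ᗮ)).map fun u : ↥(ξ.1ᗮ) => ξ.shift (u : Euc n) := by
    refine Measure.measurable_of_measurable_coe _ fun s hs => ?_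
    -- The spaces `ξᗮ` vary with `ξ`, so measurability is tested after pulling back along the
    -- surjective orbit map, where all integrals are over `X.1ᗮ`.
    rw [← hact.measurable_comp_iff_of_surjective X.surjective_act]
    have h : Measurable fun g : OrthGroup n => ∫⁻ u : X.1ᗮ,
        s.indicator (1 : AffGr n j → ℝ≥0∞) (planeMap X (g, u)) :=
      ((measurable_one.indicator hs).comp hX).lintegral_prod_right'
    rw [← funext (key hs)] at h
    exact h
  have hgr : grMeasure (Euc n) j = (orthHaar n).map fun g => X.act g :=
    grMeasure_eq_map (LinearIsometryEquiv.refl ℝ (Euc n)) X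
  ext s hs
  have h1 := lintegral_map (μ := orthHaar n) ((Measure.measurable_coe hs).comp hmeas) hact
  rw [affMeasure, Measure.bind_apply hs hmeas.aemeasurable, hgr]
  refine h1.trans ?_
  rw [← lintegral_indicator_one hs,
    lintegral_map (measurable_one.indicator hs) hX,
    lintegral_prod (fun p => s.indicator (1 : AffGr n j → ℝ≥0∞) (planeMap X p))
      ((measurable_one.indicator hs).comp hX).aemeasurable]
  exact lintegral_congr fun g => key hs g

instance affMeasure.instSFinite : SFinite (affMeasure n j) := by
  by_cases h : Nonempty (Gr (Euc n) j)
  · rw [affMeasure_eq_map h.some]; infer_instance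
  · have : IsEmpty (AffGr n j) := ⟨fun τ => h ⟨⟨τ.1.direction, τ.2.2⟩⟩⟩
    rw [Measure.eq_zero_of_isEmpty (affMeasure n j)]; infer_instance

/-! ### The mixed Radon transform as a kernel -/

theorem Gr.lift_eq_push {X : Submodule ℝ (Euc n)} (ξ : Gr X j) :
    ξ.lift = ξ.push X.subtypeₗᵢ := rfl

theorem Gr.continuous_lift {X : Submodule ℝ (Euc n)} :
    Continuous (Gr.lift : Gr X j → Gr (Euc n) j) :=
  Gr.continuous_push X.subtypeₗᵢ

theorem Gr.lift_le {X : Submodule ℝ (Euc n)} (ξ : Gr X j) : ξ.lift.1 ≤ X :=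
  Submodule.map_subtype_le X ξ.1

theorem continuous_lift_shift (X Y : Submodule ℝ (Euc n)) (w : Euc n) :
    Continuous fun p : Gr X j × Y => p.1.lift.shift ((p.2 : Euc n) + w) := by
  have h : Continuous fun p : Gr X j × Y => (p.1.lift, (p.2 : Euc n) + w) :=
    (Gr.continuous_lift.comp continuous_fst).prodMk
      ((continuous_subtype_val.comp continuous_snd).add continuous_const)
  have h2 := (Gr.continuous_shift (n := n) (j := j)).comp h
  exact h2

/-- The measure that the mixed Radon transform integrates against. -/
def radonMeasure (j : ℕ) (η : Submodule ℝ (Euc n)) (w : Euc n) : Measure (AffGr n j) :=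
  ((grMeasure ↥(ηᗮ) j).prod (volume : Measure η)).map
    fun p => p.1.lift.shift ((p.2 : Euc n) + w)

instance grMeasure.instSFinite {V : Type*} [NormedAddCommGroup V] [InnerProductSpace ℝ V]
    [FiniteDimensional ℝ V] : SFinite (grMeasure V j) := by
  unfold grMeasure
  split_ifs <;> infer_instance

theorem lintegral_radonMeasure (η : Submodule ℝ (Euc n)) (w : Euc n) {F : AffGr n j → ℝ≥0∞}
    (hF : Measurable F) : ∫⁻ τ, F τ ∂(radonMeasure j η w) =
      ∫⁻ ξ : Gr ↥(ηᗮ) j, (∫⁻ u : η, F (ξ.lift.shift ((u : Euc n) + w)))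
        ∂(grMeasure ↥(ηᗮ) j) := by
  have hc := (continuous_lift_shift (j := j) ηᗮ η w).measurable
  rw [radonMeasure, lintegral_map hF hc, lintegral_prod
    (fun p : Gr ↥(ηᗮ) j × η => F (p.1.lift.shift ((p.2 : Euc n) + w))) (hF.comp hc).aemeasurable]

theorem lintegral_grMeasure_lift_map {A B : Submodule ℝ (Euc n)} (g : OrthGroup n)
    (h : B = A.map (orthIso n g).toLinearIsometry.toLinearMap) (hj : j ≤ finrank ℝ A)
    {H : Gr (Euc n) j → ℝ≥0∞} (hH : Measurable H) :
    ∫⁻ ξ : Gr B j, H ξ.lift ∂(grMeasure B j) =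
      ∫⁻ ξ : Gr A j, H (ξ.lift.act g) ∂(grMeasure A j) := by
  subst h
  let T : A ≃ₗᵢ[ℝ] A.map (orthIso n g).toLinearIsometry.toLinearMap := (orthIso n g).submoduleMap A
  have h1 := lintegral_map (μ := grMeasure A j) (hH.comp (Gr.continuous_lift (j := j)).measurable)
    (Gr.continuous_push T.toLinearIsometry).measurable
  rw [grMeasure_map_push hj T] at h1
  refine h1.trans (lintegral_congr fun ξ => ?_)
  simp only [Function.comp_apply, Gr.lift_eq_push, Gr.act, Gr.push_push]
  rfl

/-- The plane `g (ξ + (u + v))`. -/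
def flagMap (Y : Gr (Euc n) k) (g : OrthGroup n) (v : Euc n) (ξ : Gr ↥(Y.1ᗮ) j) (u : Euc n) :
    AffGr n j :=
  (ξ.lift.act g).shift (orthIso n g (u + v))

theorem continuous_flagMap (Y : Gr (Euc n) k) :
    Continuous fun p : OrthGroup n × Euc n × Gr ↥(Y.1ᗮ) j × Euc n =>
      flagMap Y p.1 p.2.1 p.2.2.1 p.2.2.2 := by
  have h : Continuous fun p : OrthGroup n × Euc n × Gr ↥(Y.1ᗮ) j × Euc n =>
      (p.1, p.2.2.1.lift, p.2.2.2 + p.2.1) :=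
    continuous_fst.prodMk ((Gr.continuous_lift.comp continuous_snd.snd.fst).prodMk
      (continuous_snd.snd.snd.add continuous_snd.fst))
  have h2 := (continuous_act_shift (n := n) (j := j)).comp h
  exact h2

theorem lintegral_radonMeasure_act (Y : Gr (Euc n) k) (hj : j ≤ finrank ℝ Y.1ᗮ)
    (g : OrthGroup n) (v : Euc n) {F : AffGr n j → ℝ≥0∞} (hF : Measurable F) :
    ∫⁻ τ, F τ ∂(radonMeasure j (Y.act g).1 (orthIso n g v)) =
      ∫⁻ ξ : Gr ↥(Y.1ᗮ) j, (∫⁻ u : Y.1, F (flagMap Y g v ξ u)) ∂(grMeasure ↥(Y.1ᗮ) j) := by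
  have hm : Measurable fun p : Gr (Euc n) j × Y.1 =>
      F (p.1.shift (orthIso n g (p.2 + v))) := by
    refine hF.comp (Continuous.measurable ?_)
    have h : Continuous fun p : Gr (Euc n) j × Y.1 => (p.1, orthIso n g (p.2 + v)) := by
      fun_prop
    exact (Gr.continuous_shift (n := n) (j := j)).comp h
  have h1 : ∀ ξ : Gr (Euc n) j, ∫⁻ u : (Y.act g).1, F (ξ.shift ((u : Euc n) + orthIso n g v)) =
      ∫⁻ u : Y.1, F (ξ.shift (orthIso n g (u + v))) := by
    intro ξ
    refine (lintegral_submodule_map (orthIso n g) Y.1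
      fun x => F (ξ.shift (x + orthIso n g v))).trans ?_
    simp only [map_add]
  rw [lintegral_radonMeasure _ _ hF]
  simp only [h1]
  exact lintegral_grMeasure_lift_map g (Y.orthogonal_act g) hj
    (H := fun ξ => ∫⁻ u : Y.1, F (ξ.shift (orthIso n g (u + v)))) hm.lintegral_prod_right'

theorem radonMeasure_planeMap (Y : Gr (Euc n) k) (p : OrthGroup n × Y.1ᗮ) :
    radonMeasure j (planeMap Y p).1.direction (planeMap Y p).foot =
      radonMeasure j (Y.act p.1).1 (orthIso n p.1 p.2) := by
  rw [foot_planeMap, planeMap, Gr.direction_shift]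

theorem lintegral_radonMeasure_planeMap (Y : Gr (Euc n) k) (hj : j ≤ finrank ℝ Y.1ᗮ)
    (p : OrthGroup n × Y.1ᗮ) {F : AffGr n j → ℝ≥0∞} (hF : Measurable F) :
    ∫⁻ τ, F τ ∂(radonMeasure j (planeMap Y p).1.direction (planeMap Y p).foot) =
      ∫⁻ ξ : Gr ↥(Y.1ᗮ) j, (∫⁻ u : Y.1, F (flagMap Y p.1 p.2 ξ u)) ∂(grMeasure ↥(Y.1ᗮ) j) := by
  rw [radonMeasure_planeMap, lintegral_radonMeasure_act Y hj _ _ hF]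

theorem Gr.finrank_orthogonal_nat (Y : Gr (Euc n) k) : finrank ℝ Y.1ᗮ = n - k := by
  have := Y.1.finrank_add_finrank_orthogonal
  rw [Y.2, finrank_euclideanSpace_fin] at this
  omega

/-- Pulled back along the surjection `planeMap Y`, the measure is described by integrals over the
fixed spaces `G_j(Yᗮ)` and `Y`, where measurability is that of a parametric integral. -/
theorem measurable_radonMeasure (hjk : j + k ≤ n) : Measurable fun ζ : AffGr n k =>
    radonMeasure j ζ.1.direction ζ.foot := by
  obtain Y : Gr (Euc n) k := coordGr (by omega)
  refine Measure.measurable_of_measurable_coe _ fun s hs => ?_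
  rw [← (continuous_planeMap Y).measurable.measurable_comp_iff_of_surjective
    (surjective_planeMap Y)]
  have h : Measurable fun p : OrthGroup n × Y.1ᗮ => ∫⁻ ξ : Gr ↥(Y.1ᗮ) j,
      (∫⁻ u : Y.1, s.indicator (1 : AffGr n j → ℝ≥0∞) (flagMap Y p.1 p.2 ξ u))
        ∂(grMeasure ↥(Y.1ᗮ) j) := by
    have hc : Continuous fun q : ((OrthGroup n × Y.1ᗮ) × Gr ↥(Y.1ᗮ) j) × Y.1 =>
        (q.1.1.1, (q.1.1.2 : Euc n), q.1.2, (q.2 : Euc n)) :=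
      continuous_fst.fst.fst.prodMk ((continuous_subtype_val.comp continuous_fst.fst.snd).prodMk
        (continuous_fst.snd.prodMk (continuous_subtype_val.comp continuous_snd)))
    have hF : Measurable (s.indicator (1 : AffGr n j → ℝ≥0∞)) := measurable_one.indicator hs
    have h1 := ((hF.comp (continuous_flagMap (j := j) Y).measurable).comp
      hc.measurable).lintegral_prod_right' (ν := (volume : Measure Y.1))
    exact h1.lintegral_prod_right' (ν := grMeasure ↥(Y.1ᗮ) j)
  refine (iff_of_eq (congrArg Measurable (funext fun p => ?_))).1 h
  rw [Function.comp_apply, ← lintegral_indicator_one hs, lintegral_radonMeasure_planeMap Y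
    (by rw [Y.finrank_orthogonal_nat]; omega) p (measurable_one.indicator hs)]

/-- Both `w` and `ξ` lie in `ηᗮ`, so projecting along `ξ` leaves the component `u ∈ η` untouched. -/
theorem norm_le_dist0_of_mem {η : Submodule ℝ (Euc n)} {w : Euc n} (hw : w ∈ ηᗮ)
    (ξ : Gr ↥(ηᗮ) j) (u : η) : ‖u‖ ≤ (ξ.lift.shift ((u : Euc n) + w)).dist0 := by
  rw [Gr.dist0_shift, Submodule.coe_norm]
  have h1 : w - ξ.lift.1.starProjection (u + w) ∈ ηᗮ :=
    sub_mem hw (ξ.lift_le (Submodule.starProjection_apply_mem _ _))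
  have h2 := norm_add_sq_real (u : Euc n) (w - ξ.lift.1.starProjection (u + w))
  rw [h1 _ u.2, ← add_sub_assoc] at h2
  refine le_of_sq_le_sq ?_ (norm_nonneg _)
  rw [h2]
  nlinarith [sq_nonneg ‖w - ξ.lift.1.starProjection (u + w)‖]

open ProbabilityTheory

/-- The mixed Radon transform as a kernel. -/
def radonKernel (hjk : j + k ≤ n) : Kernel (AffGr n k) (AffGr n j) :=
  ⟨fun ζ => radonMeasure j ζ.1.direction ζ.foot, measurable_radonMeasure hjk⟩

/-- A plane `ξ + u + v` at distance less than `r` has `‖u‖ < r`, and `ξ` runs over a probability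
space. The bound is uniform in `ζ`, as s-finiteness of the kernel requires. -/
theorem radonMeasure_le_ball (hjk : j + k ≤ n) (ζ : AffGr n k) (r : ℝ) :
    radonMeasure j ζ.1.direction ζ.foot {τ | τ.dist0 < r} ≤
      volume (Metric.ball (0 : Euc k) r) := by
  have hs : MeasurableSet {τ : AffGr n j | τ.dist0 < r} :=
    measurableSet_lt AffGr.continuous_dist0.measurable measurable_const
  have hc := (continuous_lift_shift (j := j) ζ.1.directionᗮ ζ.1.direction ζ.foot).measurable
  have hf : finrank ℝ ζ.1.directionᗮ = n - k :=
    Gr.finrank_orthogonal_nat (⟨ζ.1.direction, ζ.2.2⟩ : Gr (Euc n) k)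
  have := isProbabilityMeasure_grMeasure (V := ↥(ζ.1.directionᗮ)) (j := j) (by omega)
  have hball : volume (Metric.ball (0 : ζ.1.direction) r) = volume (Metric.ball (0 : Euc k) r) := by
    let T : ζ.1.direction ≃ₗᵢ[ℝ] Euc k :=
      ((stdOrthonormalBasis ℝ ζ.1.direction).reindex (finCongr ζ.2.2)).repr
    rw [← T.measurePreserving.measure_preimage measurableSet_ball.nullMeasurableSet]
    congr 1
    ext x
    simp
  rw [radonMeasure, Measure.map_apply hc hs, ← hball]
  calc _ ≤ ((grMeasure ↥(ζ.1.directionᗮ) j).prod (volume : Measure ζ.1.direction))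
        (Set.univ ×ˢ Metric.ball 0 r) := by
        refine measure_mono fun p hp => ⟨trivial, ?_⟩
        rw [mem_ball_zero_iff]
        exact (norm_le_dist0_of_mem ζ.foot_mem_orthogonal p.1 p.2).trans_lt hp
    _ = _ := by rw [Measure.prod_prod, measure_univ, one_mul]

instance radonKernel.instIsSFiniteKernel (hjk : j + k ≤ n) : IsSFiniteKernel (radonKernel hjk) := by
  -- Cutting by the integer part of the distance to the origin writes the kernel as a countable sum
  -- of finite kernels.
  let s : ℕ → Set (AffGr n j) := fun N => {τ | ⌊τ.dist0⌋₊ = N}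
  have hs : ∀ N, MeasurableSet (s N) := fun N =>
    (Nat.measurable_floor.comp AffGr.continuous_dist0.measurable) (measurableSet_singleton N)
  refine ⟨fun N => (radonKernel hjk).restrict (hs N), fun N => ?_, ?_⟩
  · refine ⟨volume (Metric.ball (0 : Euc k) (N + 1)), measure_ball_lt_top, fun ζ => ?_⟩
    rw [Kernel.restrict_apply, Measure.restrict_apply_univ]
    refine (measure_mono fun τ hτ => ?_).trans (radonMeasure_le_ball hjk ζ (N + 1))
    have h := Nat.lt_floor_add_one τ.dist0
    rw [show ⌊τ.dist0⌋₊ = N from hτ] at h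
    exact h
  · ext1 ζ
    rw [Kernel.sum_apply]
    simp only [Kernel.restrict_apply]
    have hd : Pairwise (Function.onFun Disjoint s) := fun a b hab =>
      Set.disjoint_left.2 fun τ h1 h2 => hab (h1.symm.trans h2)
    rw [← Measure.restrict_iUnion hd hs]
    rw [show (⋃ N, s N) = Set.univ from Set.eq_univ_of_forall fun τ => Set.mem_iUnion.2 ⟨_, rfl⟩,
      Measure.restrict_univ]

/-! ### Integrating the mixed Radon transform against a radial weight -/

theorem radonKernel_apply (hjk : j + k ≤ n) (ζ : AffGr n k) :
    radonKernel hjk ζ = radonMeasure j ζ.1.direction ζ.foot := rfl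

theorem orthIso_starProjection (g : OrthGroup n) (Y : Gr (Euc n) k) (x : Euc n) :
    orthIso n g (Y.1.starProjection x) = (Y.act g).1.starProjection (orthIso n g x) :=
  (orthIso n g).toLinearIsometry.map_starProjection Y.1 x

theorem norm_sub_starProjection_orthIso {Y : Gr (Euc n) k} {g : OrthGroup n} (h : Y.act g = Y)
    (x : Euc n) :
    ‖orthIso n g x - Y.1.starProjection (orthIso n g x)‖ = ‖x - Y.1.starProjection x‖ := by
  have h1 := orthIso_starProjection g Y x
  rw [h] at h1
  rw [← h1, ← map_sub, LinearIsometryEquiv.norm_map]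

/-- The integral over all positions of a pair of orthogonal subspaces `X`, `Y`. -/
def flagIntegral (Y : Gr (Euc n) k) (w : ℝ → ℝ≥0∞) (F : AffGr n j → ℝ≥0∞) (X : Gr (Euc n) j) :
    ℝ≥0∞ :=
  ∫⁻ g, (∫⁻ x : Euc n, F ((X.act g).shift (orthIso n g x)) * w ‖x - Y.1.starProjection x‖)
    ∂(orthHaar n)

/-- Substitute `g ↦ g * h` by right invariance of Haar measure and `x ↦ h x` in `ℝⁿ`; the weight is
unchanged since `h` preserves `Y`. -/
theorem flagIntegral_act {Y : Gr (Euc n) k} {h : OrthGroup n} (hY : Y.act h = Y) (w : ℝ → ℝ≥0∞)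
    (F : AffGr n j → ℝ≥0∞) (X : Gr (Euc n) j) :
    flagIntegral Y w F (X.act h) = flagIntegral Y w F X := by
  unfold flagIntegral
  rw [← lintegral_orthHaar_mul_right h fun g => ∫⁻ x : Euc n,
    F ((X.act g).shift (orthIso n g x)) * w ‖x - Y.1.starProjection x‖]
  refine lintegral_congr fun g => ?_
  rw [← lintegral_isometry (orthIso n h)]
  simp only [norm_sub_starProjection_orthIso hY, Gr.act_mul, orthIso_mul_apply]

theorem flagIntegral_eq_of_isOrtho {Y : Gr (Euc n) k} {X X' : Gr (Euc n) j} (hX : X.1 ⟂ Y.1)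
    (hX' : X'.1 ⟂ Y.1) (w : ℝ → ℝ≥0∞) (F : AffGr n j → ℝ≥0∞) :
    flagIntegral Y w F X' = flagIntegral Y w F X := by
  obtain ⟨h, h1, h2⟩ := exists_act_pair hX hX' (X.2.trans X'.2.symm) rfl
  have h1' : X.act h = X' := Subtype.ext h1
  rw [← h1', flagIntegral_act (Subtype.ext h2)]

theorem measurable_norm_sub_starProjection (Y : Submodule ℝ (Euc n)) :
    Measurable fun x : Euc n => ‖x - Y.starProjection x‖ := by fun_prop

theorem measurable_flagMap {α : Type*} [MeasurableSpace α] (Y : Gr (Euc n) k)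
    {g : α → OrthGroup n} {v u : α → Euc n} {ξ : α → Gr ↥(Y.1ᗮ) j} (hg : Measurable g)
    (hv : Measurable v) (hξ : Measurable ξ) (hu : Measurable u) :
    Measurable fun a => flagMap Y (g a) (v a) (ξ a) (u a) := by
  have h := (continuous_flagMap (j := j) Y).measurable.comp
    (hg.prodMk (hv.prodMk (hξ.prodMk hu)))
  exact h

theorem lintegral_radonKernel_planeMap_mul (hjk : j + k ≤ n) (Y : Gr (Euc n) k)
    (w : ℝ → ℝ≥0∞) {F : AffGr n j → ℝ≥0∞} (hF : Measurable F) (p : OrthGroup n × Y.1ᗮ) :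
    (∫⁻ τ, F τ ∂(radonKernel hjk (planeMap Y p))) * w (planeMap Y p).dist0 =
      ∫⁻ ξ : Gr ↥(Y.1ᗮ) j, (∫⁻ u : Y.1, F (flagMap Y p.1 p.2 ξ u) * w ‖p.2‖)
        ∂(grMeasure ↥(Y.1ᗮ) j) := by
  have hj : j ≤ finrank ℝ Y.1ᗮ := by rw [Y.finrank_orthogonal_nat]; omega
  have hu : Measurable fun q : Gr ↥(Y.1ᗮ) j × Y.1 => F (flagMap Y p.1 p.2 q.1 q.2) :=
    hF.comp (measurable_flagMap Y measurable_const measurable_const measurable_fst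
      measurable_snd.subtype_val)
  have hu' : Measurable fun ξ : Gr ↥(Y.1ᗮ) j => ∫⁻ u : Y.1, F (flagMap Y p.1 p.2 ξ u) :=
    hu.lintegral_prod_right'
  have hu2 : ∀ ξ : Gr ↥(Y.1ᗮ) j, Measurable fun u : Y.1 => F (flagMap Y p.1 p.2 ξ u) := fun ξ =>
    hF.comp (measurable_flagMap Y measurable_const measurable_const measurable_const
      measurable_subtype_coe)
  rw [radonKernel_apply, lintegral_radonMeasure_planeMap Y hj p hF, dist0_planeMap,
    ← lintegral_mul_const _ hu']
  exact lintegral_congr fun ξ => (lintegral_mul_const _ (hu2 ξ)).symm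

theorem lintegral_radonKernel_eq_flagIntegral (hjk : j + k ≤ n) {X : Gr (Euc n) j}
    {Y : Gr (Euc n) k} (hXY : X.1 ⟂ Y.1) {w : ℝ → ℝ≥0∞} (hw : Measurable w)
    {F : AffGr n j → ℝ≥0∞} (hF : Measurable F) :
    ∫⁻ ζ, (∫⁻ τ, F τ ∂(radonKernel hjk ζ)) * w ζ.dist0 ∂(affMeasure n k) =
      flagIntegral Y w F X := by
  have hj : j ≤ finrank ℝ Y.1ᗮ := by rw [Y.finrank_orthogonal_nat]; omega
  have := isProbabilityMeasure_grMeasure hj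
  have hm : Measurable fun q : ((OrthGroup n × Y.1ᗮ) × Gr ↥(Y.1ᗮ) j) × Y.1 =>
      F (flagMap Y q.1.1.1 q.1.1.2 q.1.2 q.2) * w ‖q.1.1.2‖ :=
    (hF.comp (measurable_flagMap Y measurable_fst.fst.fst measurable_fst.fst.snd.subtype_val
      measurable_fst.snd measurable_snd.subtype_val)).mul
      (hw.comp measurable_fst.fst.snd.norm)
  have hm1 : Measurable fun q : (OrthGroup n × Y.1ᗮ) × Gr ↥(Y.1ᗮ) j =>
      ∫⁻ u : Y.1, F (flagMap Y q.1.1 q.1.2 q.2 u) * w ‖q.1.2‖ := hm.lintegral_prod_right'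
  have hζ : Measurable fun ζ : AffGr n k => (∫⁻ τ, F τ ∂(radonKernel hjk ζ)) * w ζ.dist0 :=
    (hF.lintegral_kernel).mul (hw.comp AffGr.continuous_dist0.measurable)
  rw [affMeasure_eq_map Y, lintegral_map hζ (continuous_planeMap Y).measurable]
  simp only [lintegral_radonKernel_planeMap_mul hjk Y w hF]
  rw [lintegral_lintegral_swap hm1.aemeasurable]
  refine lintegral_grMeasure_eq_of_const hj fun ξ => ?_
  have hm3 : Measurable fun q : (OrthGroup n × Y.1ᗮ) × Y.1 =>
      F (flagMap Y q.1.1 q.1.2 ξ q.2) * w ‖q.1.2‖ :=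
    (hF.comp (measurable_flagMap Y measurable_fst.fst measurable_fst.snd.subtype_val
      measurable_const measurable_snd.subtype_val)).mul (hw.comp measurable_fst.snd.norm)
  have hm2 : Measurable fun p : OrthGroup n × Y.1ᗮ =>
      ∫⁻ u : Y.1, F (flagMap Y p.1 p.2 ξ u) * w ‖p.2‖ := hm3.lintegral_prod_right'
  have hξ : ξ.lift.1 ⟂ Y.1 := (Submodule.isOrtho_iff_le).2 ξ.lift_le
  -- For each fixed `ξ ⟂ Y` the remaining integral is the flag integral of `ξ`, equal to that of
  -- `X`; the average over `ξ` is then trivial.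
  rw [lintegral_prod _ hm2.aemeasurable, ← flagIntegral_eq_of_isOrtho hXY hξ]
  refine lintegral_congr fun g => ?_
  have hx : Measurable fun x : Euc n =>
      F ((ξ.lift.act g).shift (orthIso n g x)) * w ‖x - Y.1.starProjection x‖ := by
    have h1 : Measurable fun x : Euc n => (ξ.lift.act g).shift (orthIso n g x) :=
      (Gr.continuous_shift.comp (continuous_const.prodMk (orthIso n g).continuous)).measurable
    exact (hF.comp h1).mul (hw.comp (measurable_norm_sub_starProjection Y.1))
  rw [lintegral_orthogonal_decomposition Y.1 hx, lintegral_lintegral_swap]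
  · refine lintegral_congr fun u => lintegral_congr fun v => ?_
    have h1 : Y.1.starProjection ((u : Euc n) + v) = u := by
      rw [map_add, Submodule.starProjection_eq_self_iff.2 u.2,
        (Submodule.starProjection_apply_eq_zero_iff _).2 v.2, add_zero]
    rw [h1, add_sub_cancel_left]
    rfl
  · have hm4 : Measurable fun q : Y.1ᗮ × Y.1 => F (flagMap Y g q.1 ξ q.2) * w ‖q.1‖ :=
      (hF.comp (measurable_flagMap Y measurable_const measurable_fst.subtype_val
        measurable_const measurable_snd.subtype_val)).mul (hw.comp measurable_fst.norm)
    exact hm4.aemeasurable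

/-- The plane `g(X + x)` depends only on the `Xᗮ`-component `z` of `x`. As `X ⟂ Y`, `P_Y` kills the
component `y ∈ X`, and `y` is orthogonal to `z - P_Y z`, so the weight follows from Pythagoras. -/
theorem flagIntegral_eq_lintegral_planeMap {X : Gr (Euc n) j} {Y : Gr (Euc n) k}
    (hXY : X.1 ⟂ Y.1) {w : ℝ → ℝ≥0∞} (hw : Measurable w)
    {F : AffGr n j → ℝ≥0∞} (hF : Measurable F) :
    flagIntegral Y w F X = ∫⁻ g, (∫⁻ z : X.1ᗮ, F (planeMap X (g, z)) *
      ∫⁻ y : X.1, w (Real.sqrt (‖y‖ ^ 2 + ‖(z : Euc n) - Y.1.starProjection z‖ ^ 2)))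
        ∂(orthHaar n) := by
  refine lintegral_congr fun g => ?_
  have h1 : Measurable fun x : Euc n => (X.act g).shift (orthIso n g x) :=
    (Gr.continuous_shift.comp (continuous_const.prodMk (orthIso n g).continuous)).measurable
  have hx : Measurable fun x : Euc n =>
      F ((X.act g).shift (orthIso n g x)) * w ‖x - Y.1.starProjection x‖ :=
    (hF.comp h1).mul (hw.comp (measurable_norm_sub_starProjection Y.1))
  have hxx : Measurable fun q : X.1 × X.1ᗮ =>
      F ((X.act g).shift (orthIso n g ((q.1 : Euc n) + q.2))) *
        w ‖(q.1 : Euc n) + q.2 - Y.1.starProjection ((q.1 : Euc n) + q.2)‖ := by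
    have h2 : Measurable fun q : X.1 × X.1ᗮ => (q.1 : Euc n) + q.2 := by fun_prop
    have h3 := hx.comp h2
    exact h3
  rw [lintegral_orthogonal_decomposition X.1 hx, lintegral_lintegral_swap hxx.aemeasurable]
  refine lintegral_congr fun z => ?_
  rw [← lintegral_const_mul _ (by fun_prop)]
  refine lintegral_congr fun y => ?_
  have hy : Y.1.starProjection (y : Euc n) = 0 := by
    rw [Submodule.starProjection_apply_eq_zero_iff]
    exact (Submodule.isOrtho_iff_le.1 hXY) y.2
  have h2 : (X.act g).shift (orthIso n g ((y : Euc n) + z)) = planeMap X (g, z) := by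
    refine (Gr.shift_eq_shift_iff _ _ _).2 ?_
    rw [← map_sub, add_sub_cancel_right]
    exact ⟨y, y.2, rfl⟩
  have h3 : inner ℝ (y : Euc n) ((z : Euc n) - Y.1.starProjection z) = 0 := by
    rw [inner_sub_right, z.2 _ y.2,
      hXY.inner_eq y.2 (Submodule.starProjection_apply_mem _ _), sub_zero]
  have h4 := norm_add_sq_real (y : Euc n) ((z : Euc n) - Y.1.starProjection z)
  rw [h3, mul_zero, add_zero] at h4
  rw [h2, map_add, hy, zero_add, add_sub_assoc, ← Real.sqrt_sq (norm_nonneg (_ + _)), h4]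
  rfl

theorem coe_starProjection_lift {A : Submodule ℝ (Euc n)} (Y : Gr A k) (z : A) :
    Y.lift.1.starProjection (z : Euc n) = Y.1.starProjection z :=
  (A.subtypeₗᵢ.map_starProjection Y.1 z).symm

/-- A weighted integral of the mixed Radon transform, once the two radial integrals of the weight
are known. -/
theorem lintegral_radonKernel_mul (hjk : j + k < n) {w W w' : ℝ → ℝ≥0∞} (hw : Measurable w)
    (hW : Measurable W) (hw' : Measurable w') {c : ℝ≥0∞}
    (hwW : ∀ (X : Gr (Euc n) j) (s : ℝ), 0 < s →
      ∫⁻ y : X.1, w (Real.sqrt (‖y‖ ^ 2 + s ^ 2)) = W s)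
    (hWw' : ∀ (X : Gr (Euc n) j) (z : X.1ᗮ), ∫⁻ Y : Gr ↥(X.1ᗮ) k,
      W ‖z - Y.1.starProjection z‖ ∂(grMeasure ↥(X.1ᗮ) k) = c * w' ‖z‖)
    {F : AffGr n j → ℝ≥0∞} (hF : Measurable F) :
    ∫⁻ ζ, (∫⁻ τ, F τ ∂(radonKernel hjk.le ζ)) * w ζ.dist0 ∂(affMeasure n k) =
      c * ∫⁻ τ, F τ * w' τ.dist0 ∂(affMeasure n j) := by
  obtain X : Gr (Euc n) j := coordGr (by omega)
  have hk : k < finrank ℝ X.1ᗮ := by rw [X.finrank_orthogonal_nat]; omega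
  have := isProbabilityMeasure_grMeasure hk.le
  have hplane : Measurable fun p : OrthGroup n × X.1ᗮ => F (planeMap X p) :=
    hF.comp (continuous_planeMap X).measurable
  have hnorm : Measurable fun q : Gr ↥(X.1ᗮ) k × X.1ᗮ => W ‖q.2 - q.1.1.starProjection q.2‖ :=
    hW.comp Gr.continuous_norm_sub_starProjection.measurable
  -- Every `Y ⊆ Xᗮ` gives the same left side, so averaging over `Y` changes nothing and brings in
  -- the mean of `W`.
  have h1 : ∀ Y : Gr ↥(X.1ᗮ) k,
      ∫⁻ p : OrthGroup n × X.1ᗮ, F (planeMap X p) * W ‖p.2 - Y.1.starProjection p.2‖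
        ∂((orthHaar n).prod volume) =
      ∫⁻ ζ, (∫⁻ τ, F τ ∂(radonKernel hjk.le ζ)) * w ζ.dist0 ∂(affMeasure n k) := by
    intro Y
    have hXY : X.1 ⟂ Y.lift.1 := ((Submodule.isOrtho_iff_le).2 Y.lift_le).symm
    rw [lintegral_radonKernel_eq_flagIntegral hjk.le hXY hw hF,
      flagIntegral_eq_lintegral_planeMap hXY hw hF, lintegral_prod]
    · refine lintegral_congr fun g => lintegral_congr_ae ?_
      -- Points `z ∈ Y` give `s = 0`, which `hwW` excludes. They form a null set because `j + k < n`
      -- makes `Y` a proper subspace of `Xᗮ`.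
      have hnull : volume (Y.1 : Set X.1ᗮ) = 0 := by
        refine Measure.addHaar_submodule _ _ fun h => ?_
        have h2 := Y.2
        rw [h, finrank_top] at h2
        omega
      filter_upwards [compl_mem_ae_iff.2 hnull] with z hz
      have hpos : 0 < ‖z - Y.1.starProjection z‖ := by
        rw [norm_pos_iff, sub_ne_zero]
        exact fun h => hz (Submodule.starProjection_eq_self_iff.1 h.symm)
      rw [← hwW X _ hpos, coe_starProjection_lift]
      rfl
    · have h2 : Measurable fun p : OrthGroup n × X.1ᗮ => W ‖p.2 - Y.1.starProjection p.2‖ := by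
        have h3 : Measurable fun p : OrthGroup n × X.1ᗮ => ‖p.2 - Y.1.starProjection p.2‖ := by
          fun_prop
        exact hW.comp h3
      exact (hplane.mul h2).aemeasurable
  have hd : Measurable fun τ : AffGr n j => F τ * w' τ.dist0 :=
    hF.mul (hw'.comp AffGr.continuous_dist0.measurable)
  have hd' : Measurable fun p : OrthGroup n × X.1ᗮ => F (planeMap X p) * w' (planeMap X p).dist0 :=
    hd.comp (continuous_planeMap X).measurable
  have hnorm' : ∀ z : X.1ᗮ, Measurable fun Y : Gr ↥(X.1ᗮ) k => W ‖z - Y.1.starProjection z‖ :=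
    fun z => hW.comp (Gr.measurable_norm_sub_starProjection z)
  have hswap : Measurable fun q : Gr ↥(X.1ᗮ) k × (OrthGroup n × X.1ᗮ) =>
      F (planeMap X q.2) * W ‖q.2.2 - q.1.1.starProjection q.2.2‖ := by
    have h2 : Measurable fun q : Gr ↥(X.1ᗮ) k × (OrthGroup n × X.1ᗮ) => (q.1, q.2.2) :=
      measurable_fst.prodMk measurable_snd.snd
    have h3 := hnorm.comp h2
    exact (hF.comp ((continuous_planeMap X).measurable.comp measurable_snd)).mul h3
  rw [← lintegral_grMeasure_eq_of_const hk.le h1, lintegral_lintegral_swap hswap.aemeasurable,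
    affMeasure_eq_map X, lintegral_map hd (continuous_planeMap X).measurable,
    ← lintegral_const_mul _ hd']
  refine lintegral_congr fun p => ?_
  rw [lintegral_const_mul _ (hnorm' _), hWw', dist0_planeMap]
  ring

/-! ### From nonnegative functions to integrable functions -/

theorem mixedRadonAbs_eq_lintegral (hjk : j + k ≤ n) {f : AffGr n j → ℂ} {ζ : AffGr n k}
    (hf : AEStronglyMeasurable f (radonKernel hjk ζ)) :
    mixedRadonAbs j k f ζ = ∫⁻ τ, ‖f τ‖ₑ ∂(radonKernel hjk ζ) := by
  have hc := (continuous_lift_shift (j := j) ζ.1.directionᗮ ζ.1.direction ζ.foot).measurable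
  rw [radonKernel_apply, radonMeasure] at hf ⊢
  rw [lintegral_map' hf.enorm hc.aemeasurable, lintegral_prod]
  · rfl
  · exact hf.enorm.comp_measurable hc

theorem mixedRadonExists_iff_integrable (hjk : j + k ≤ n) {f : AffGr n j → ℂ} {ζ : AffGr n k}
    (hf : AEStronglyMeasurable f (radonKernel hjk ζ)) :
    MixedRadonExists j k f ζ ↔ Integrable f (radonKernel hjk ζ) := by
  have hc := (continuous_lift_shift (j := j) ζ.1.directionᗮ ζ.1.direction ζ.foot).measurable
  rw [radonKernel_apply, radonMeasure] at hf ⊢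
  rw [integrable_map_measure hf hc.aemeasurable]
  rfl

theorem mixedRadon_eq_integral (hjk : j + k ≤ n) {f : AffGr n j → ℂ} {ζ : AffGr n k}
    (hf : Integrable f (radonKernel hjk ζ)) :
    mixedRadon j k f ζ = ∫ τ, f τ ∂(radonKernel hjk ζ) := by
  have hc := (continuous_lift_shift (j := j) ζ.1.directionᗮ ζ.1.direction ζ.foot).measurable
  have h := (mixedRadonExists_iff_integrable hjk hf.1).2 hf
  rw [radonKernel_apply, radonMeasure] at hf ⊢
  rw [integral_map hc.aemeasurable hf.1, integral_prod _ h]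
  rfl

/-! ### Weighted measures composed with a kernel -/

section Kernel

variable {α β : Type*} [MeasurableSpace α] [MeasurableSpace β] {m : Measure α} {m' : Measure β}

theorem ae_of_ae_withDensity_pos {w : α → ℝ} (hw : Measurable w) (hw0 : ∀ᵐ a ∂m, 0 < w a)
    {p : α → Prop} (hp : ∀ᵐ a ∂(m.withDensity fun a => ENNReal.ofReal (w a)), p a) :
    ∀ᵐ a ∂m, p a := by
  rw [ae_withDensity_iff hw.ennreal_ofReal] at hp
  filter_upwards [hp, hw0] with a h1 h2
  exact h1 (by simpa using h2)

theorem integrable_withDensity_ofReal_iff {w : α → ℝ} (hw : Measurable w)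
    (hw0 : ∀ᵐ a ∂m, 0 ≤ w a) {f : α → ℂ} :
    Integrable f (m.withDensity fun a => ENNReal.ofReal (w a)) ↔
      Integrable (fun a => f a * (w a : ℂ)) m := by
  rw [integrable_withDensity_iff_integrable_smul' hw.ennreal_ofReal
    (Filter.Eventually.of_forall fun _ => ENNReal.ofReal_lt_top)]
  refine integrable_congr ?_
  filter_upwards [hw0] with a ha
  rw [ENNReal.toReal_ofReal ha, Complex.real_smul, mul_comm]

theorem integral_withDensity_ofReal {w : α → ℝ} (hw : Measurable w)
    (hw0 : ∀ᵐ a ∂m, 0 ≤ w a) (f : α → ℂ) :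
    ∫ a, f a ∂(m.withDensity fun a => ENNReal.ofReal (w a)) = ∫ a, f a * (w a : ℂ) ∂m := by
  rw [integral_withDensity_eq_integral_toReal_smul hw.ennreal_ofReal
    (Filter.Eventually.of_forall fun _ => ENNReal.ofReal_lt_top)]
  refine integral_congr_ae ?_
  filter_upwards [hw0] with a ha
  rw [ENNReal.toReal_ofReal ha, Complex.real_smul, mul_comm]

/-- Applying the integral identity to indicators turns it into an equality of measures, which can
then be used for complex functions. -/
theorem comp_withDensity_eq_smul {κ : Kernel α β} {w : α → ℝ} (hw : Measurable w)
    {w' : β → ℝ} (hw' : Measurable w') {c : ℝ≥0∞}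
    (h : ∀ F : β → ℝ≥0∞, Measurable F → ∫⁻ a, (∫⁻ b, F b ∂(κ a)) * ENNReal.ofReal (w a) ∂m =
      c * ∫⁻ b, F b * ENNReal.ofReal (w' b) ∂m') :
    κ ∘ₘ (m.withDensity fun a => ENNReal.ofReal (w a)) =
      c • m'.withDensity fun b => ENNReal.ofReal (w' b) := by
  ext s hs
  have h1 : Measurable (s.indicator (1 : β → ℝ≥0∞)) := measurable_one.indicator hs
  rw [Measure.bind_apply hs κ.aemeasurable, Measure.smul_apply,
    lintegral_withDensity_eq_lintegral_mul _ hw.ennreal_ofReal (κ.measurable_coe hs),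
    smul_eq_mul, ← lintegral_indicator_one hs,
    lintegral_withDensity_eq_lintegral_mul _ hw'.ennreal_ofReal h1]
  have h2 := h _ h1
  simp only [lintegral_indicator_one hs] at h2
  simp only [Pi.mul_apply, mul_comm (ENNReal.ofReal (w _)), mul_comm (ENNReal.ofReal (w' _))]
  exact h2

variable [SFinite m] {κ : Kernel α β} [IsSFiniteKernel κ]

theorem lintegral_enorm_comp_withDensity {w : α → ℝ} (hw : Measurable w) {f : β → ℂ}
    (hf : AEStronglyMeasurable f (κ ∘ₘ (m.withDensity fun a => ENNReal.ofReal (w a)))) :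
    ∫⁻ b, ‖f b‖ₑ ∂(κ ∘ₘ (m.withDensity fun a => ENNReal.ofReal (w a))) =
      ∫⁻ a, (∫⁻ b, ‖f b‖ₑ ∂(κ a)) * ENNReal.ofReal (w a) ∂m := by
  rw [Measure.lintegral_bind κ.aemeasurable hf.enorm,
    lintegral_withDensity_eq_lintegral_mul_non_measurable _ hw.ennreal_ofReal
      (Filter.Eventually.of_forall fun _ => ENNReal.ofReal_lt_top)]
  simp only [Pi.mul_apply, mul_comm]

theorem ae_integrable_of_comp_withDensity {w : α → ℝ} (hw : Measurable w)
    (hw0 : ∀ᵐ a ∂m, 0 < w a) {f : β → ℂ}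
    (hf : Integrable f (κ ∘ₘ (m.withDensity fun a => ENNReal.ofReal (w a)))) :
    ∀ᵐ a ∂m, Integrable f (κ a) :=
  ae_of_ae_withDensity_pos hw hw0 ((Measure.integrable_comp_iff hf.1).1 hf).1

theorem ae_aestronglyMeasurable_of_comp_withDensity {w : α → ℝ} (hw : Measurable w)
    (hw0 : ∀ᵐ a ∂m, 0 < w a) {f : β → ℂ}
    (hf : AEStronglyMeasurable f (κ ∘ₘ (m.withDensity fun a => ENNReal.ofReal (w a)))) :
    ∀ᵐ a ∂m, AEStronglyMeasurable f (κ a) := by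
  refine ae_of_ae_withDensity_pos hw hw0 ?_
  filter_upwards [Measure.ae_ae_of_ae_comp hf.ae_eq_mk] with a ha
  exact ⟨hf.mk f, hf.stronglyMeasurable_mk, ha⟩

theorem integrable_integral_kernel {f : β → ℂ} {ν : Measure α} [SFinite ν]
    (hf : Integrable f (κ ∘ₘ ν)) : Integrable (fun a => ∫ b, f b ∂(κ a)) ν := by
  rw [Measure.comp_eq_comp_const_apply] at hf
  have h := MeasureTheory.Integrable.integral_comp hf
  rwa [Kernel.const_apply] at h

theorem integral_comp_kernel {f : β → ℂ} {ν : Measure α} [SFinite ν]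
    (hf : Integrable f (κ ∘ₘ ν)) : ∫ b, f b ∂(κ ∘ₘ ν) = ∫ a, ∫ b, f b ∂(κ a) ∂ν := by
  rw [Measure.comp_eq_comp_const_apply] at hf ⊢
  rw [Kernel.integral_comp hf, Kernel.const_apply]

end Kernel

theorem radonFormula_of_lintegral (hjk : j + k ≤ n) {f : AffGr n j → ℂ}
    (hf : AEStronglyMeasurable f (affMeasure n j)) {w : AffGr n k → ℝ} (hw : Measurable w)
    (hw0 : ∀ᵐ ζ ∂(affMeasure n k), 0 < w ζ) {w' : AffGr n j → ℝ} (hw' : Measurable w')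
    (hw0' : ∀ τ, 0 ≤ w' τ) {c : ℝ} (hc : 0 < c)
    (h : ∀ F : AffGr n j → ℝ≥0∞, Measurable F →
      ∫⁻ ζ, (∫⁻ τ, F τ ∂(radonKernel hjk ζ)) * ENNReal.ofReal (w ζ) ∂(affMeasure n k) =
        ENNReal.ofReal c * ∫⁻ τ, F τ * ENNReal.ofReal (w' τ) ∂(affMeasure n j)) :
    RadonFormula j k f w w' c := by
  have hcomp := comp_withDensity_eq_smul hw hw' h
  have hw0'' : ∀ᵐ τ ∂(affMeasure n j), 0 ≤ w' τ := Filter.Eventually.of_forall hw0'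
  have hw00 : ∀ᵐ ζ ∂(affMeasure n k), 0 ≤ w ζ := hw0.mono fun _ => le_of_lt
  have hc0 : ENNReal.ofReal c ≠ 0 := by simpa using hc
  -- The function is measurable only up to null sets of `affMeasure n j`; the equality of measures
  -- transfers this to the composed measure, hence to almost every measure of the kernel.
  have hfc : AEStronglyMeasurable f (radonKernel hjk ∘ₘ
      ((affMeasure n k).withDensity fun ζ => ENNReal.ofReal (w ζ))) := by
    rw [hcomp]
    exact (hf.mono_ac (withDensity_absolutelyContinuous _ _)).smul_measure _
  have hright : Integrable f (radonKernel hjk ∘ₘ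
      ((affMeasure n k).withDensity fun ζ => ENNReal.ofReal (w ζ))) ↔
      Integrable (fun τ => f τ * (w' τ : ℂ)) (affMeasure n j) := by
    rw [hcomp, integrable_smul_measure hc0 ENNReal.ofReal_ne_top,
      integrable_withDensity_ofReal_iff hw' hw0'']
  have habs : ∫⁻ ζ, mixedRadonAbs j k f ζ * ENNReal.ofReal (w ζ) ∂(affMeasure n k) =
      ∫⁻ ζ, (∫⁻ τ, ‖f τ‖ₑ ∂(radonKernel hjk ζ)) * ENNReal.ofReal (w ζ) ∂(affMeasure n k) := by
    refine lintegral_congr_ae ?_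
    filter_upwards [ae_aestronglyMeasurable_of_comp_withDensity hw hw0 hfc] with ζ hζ
    rw [mixedRadonAbs_eq_lintegral hjk hζ]
  have hleft : ∫⁻ ζ, mixedRadonAbs j k f ζ * ENNReal.ofReal (w ζ) ∂(affMeasure n k) < ∞ ↔
      Integrable f (radonKernel hjk ∘ₘ
        ((affMeasure n k).withDensity fun ζ => ENNReal.ofReal (w ζ))) := by
    rw [habs, ← lintegral_enorm_comp_withDensity hw hfc, Integrable, and_iff_right hfc,
      HasFiniteIntegral]
  intro hor
  have hint := hor.elim hleft.1 hright.2
  have hκint := ae_integrable_of_comp_withDensity hw hw0 hint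
  have hmix : ∀ᵐ ζ ∂(affMeasure n k), mixedRadon j k f ζ * (w ζ : ℂ) =
      (∫ τ, f τ ∂(radonKernel hjk ζ)) * (w ζ : ℂ) := by
    filter_upwards [hκint] with ζ hζ
    rw [mixedRadon_eq_integral hjk hζ]
  refine ⟨hleft.2 hint, ?_, ?_, hright.1 hint, ?_⟩
  · filter_upwards [hκint] with ζ hζ
    exact (mixedRadonExists_iff_integrable hjk hζ.1).2 hζ
  · exact (integrable_congr hmix).2
      ((integrable_withDensity_ofReal_iff hw hw00).1 (integrable_integral_kernel hint))
  · rw [integral_congr_ae hmix, ← integral_withDensity_ofReal hw hw00,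
      ← integral_comp_kernel hint, hcomp, integral_smul_measure,
      integral_withDensity_ofReal hw' hw0'', ENNReal.toReal_ofReal hc.le, Complex.real_smul]

/-! ### The two radial weights -/

/-- Planes through the origin, where the power weight takes the default value `1 / 0 = 0`, form a
null set; elsewhere that weight is positive. -/
theorem ae_dist0_pos (hk : k < n) : ∀ᵐ ζ ∂(affMeasure n k), 0 < ζ.dist0 := by
  obtain Y : Gr (Euc n) k := coordGr hk.le
  have : Nontrivial Y.1ᗮ := Module.nontrivial_of_finrank_pos (R := ℝ)
    (by rw [Y.finrank_orthogonal_nat]; omega)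
  rw [affMeasure_eq_map Y, ae_map_iff (continuous_planeMap Y).aemeasurable
    (measurableSet_lt measurable_const AffGr.continuous_dist0.measurable)]
  simp only [dist0_planeMap, norm_pos_iff]
  have h : ∀ᵐ z : Y.1ᗮ, z ≠ 0 := Measure.ae_ne _ _
  exact Measure.quasiMeasurePreserving_snd.ae h

theorem radonFormula_rpow (hj : 0 < j) (hk : 0 < k) (hjk : j + k < n) {f : AffGr n j → ℂ}
    (hf : AEStronglyMeasurable f (affMeasure n j)) {μ : ℝ} (h1 : (j : ℝ) < μ)
    (h2 : μ < (n : ℝ) - k) :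
    RadonFormula j k f (fun ζ => 1 / ζ.dist0 ^ μ) (fun τ => 1 / τ.dist0 ^ (μ - j))
      (powConst n k j μ) := by
  have hj0 : (0 : ℝ) < j := by exact_mod_cast hj
  have hk0 : (0 : ℝ) < k := by exact_mod_cast hk
  have hn : (j : ℝ) + k < n := by exact_mod_cast hjk
  have g1 : 0 < Real.Gamma (((n : ℝ) - j) / 2) := Real.Gamma_pos_of_pos (by linarith)
  have g2 : 0 < Real.Gamma ((μ - j) / 2) := Real.Gamma_pos_of_pos (by linarith)
  have g3 : 0 < Real.Gamma (((n : ℝ) - k - μ) / 2) := Real.Gamma_pos_of_pos (by linarith)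
  have g4 : 0 < Real.Gamma (((n : ℝ) - k - j) / 2) := Real.Gamma_pos_of_pos (by linarith)
  have g5 : 0 < Real.Gamma (μ / 2) := Real.Gamma_pos_of_pos (by linarith)
  have g6 : 0 < Real.Gamma (((n : ℝ) - μ) / 2) := Real.Gamma_pos_of_pos (by linarith)
  have hπ := Real.pi_pos
  have hd := (AffGr.continuous_dist0 (n := n) (j := j)).measurable
  have hd' := (AffGr.continuous_dist0 (n := n) (j := k)).measurable
  refine radonFormula_of_lintegral hjk.le hf (by fun_prop) ?_ (by fun_prop)
    (fun τ => by have : 0 ≤ τ.dist0 := Metric.infDist_nonneg; positivity)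
    (by unfold powConst; positivity) fun F hF => ?_
  · filter_upwards [ae_dist0_pos (by omega)] with ζ hζ
    positivity
  refine lintegral_radonKernel_mul hjk (w := fun r => ENNReal.ofReal (1 / r ^ μ))
    (w' := fun r => ENNReal.ofReal (1 / r ^ (μ - j)))
    (W := fun s => ENNReal.ofReal (Real.pi ^ ((j : ℝ) / 2) * Real.Gamma ((μ - j) / 2) /
      Real.Gamma (μ / 2)) * ENNReal.ofReal (s ^ (-(μ - j)))) (by fun_prop) (by fun_prop)
      (by fun_prop) (fun X s hs => ?_) (fun X z => ?_) hF
  -- The Gamma integral with `a = s ^ 2` and `p = μ / 2`; it converges because `j < μ`.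
  · have h := lintegral_rpow_neg_norm_sq_add (V := X.1) (a := s ^ 2) (p := μ / 2) (by positivity)
      (by rw [X.2]; linarith)
    rw [X.2] at h
    rw [← ENNReal.ofReal_mul (by positivity)]
    have e1 : (s ^ 2 : ℝ) ^ ((j : ℝ) / 2 - μ / 2) = s ^ (-(μ - j)) := by
      rw [← Real.rpow_natCast, ← Real.rpow_mul hs.le]
      congr 1; push_cast; ring
    rw [e1, show μ / 2 - (j : ℝ) / 2 = (μ - j) / 2 by ring] at h
    rw [← h]
    refine lintegral_congr fun y => ?_
    rw [Real.sqrt_eq_rpow, ← Real.rpow_mul (by positivity), one_div,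
      ← Real.rpow_neg (by positivity)]
    congr 2; ring
  · have hf1 : (finrank ℝ X.1ᗮ : ℝ) = (n : ℝ) - j := by
      rw [X.finrank_orthogonal, finrank_euclideanSpace_fin]
    have hf2 : finrank ℝ X.1ᗮ = n - j := X.finrank_orthogonal_nat
    -- The exponent `μ - j` has to be below `dim Xᗮ - k = n - j - k`, which is the condition `μ < n
    -- - k`.
    have h := lintegral_grMeasure_norm_rpow (V := X.1ᗮ) (k := k) (s := μ - j)
      (by rw [hf2]; omega) (by rw [hf1]; linarith) z
    have hm : Measurable fun Y : Gr ↥(X.1ᗮ) k =>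
        ENNReal.ofReal (‖z - Y.1.starProjection z‖ ^ (-(μ - j))) := by
      have := Gr.measurable_norm_sub_starProjection (k := k) z
      fun_prop
    rw [lintegral_const_mul _ hm, h, ← mul_assoc, ← ENNReal.ofReal_mul (by positivity), hf1,
      Real.rpow_neg (norm_nonneg _), one_div]
    congr 2
    rw [powConst, show (n : ℝ) - j - k - (μ - j) = n - k - μ by ring,
      show (n : ℝ) - j - (μ - j) = n - μ by ring, show (n : ℝ) - j - k = n - k - j by ring]
    field_simp

theorem radonFormula_one_add_sq (hjk : j + k < n) {f : AffGr n j → ℂ}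
    (hf : AEStronglyMeasurable f (affMeasure n j)) :
    RadonFormula j k f (fun ζ => 1 / (1 + ζ.dist0 ^ 2) ^ ((n : ℝ) / 2))
      (fun τ => 1 / (1 + τ.dist0 ^ 2) ^ (((n : ℝ) - j - k) / 2)) (ratConst n j) := by
  have hj0 : (0 : ℝ) ≤ j := by positivity
  have hk0 : (0 : ℝ) ≤ k := by positivity
  have hn : (j : ℝ) + k < n := by exact_mod_cast hjk
  have g1 : 0 < Real.Gamma (((n : ℝ) - j) / 2) := Real.Gamma_pos_of_pos (by linarith)
  have g2 : 0 < Real.Gamma ((n : ℝ) / 2) := Real.Gamma_pos_of_pos (by linarith)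
  have hπ := Real.pi_pos
  have hd := (AffGr.continuous_dist0 (n := n) (j := j)).measurable
  have hd' := (AffGr.continuous_dist0 (n := n) (j := k)).measurable
  refine radonFormula_of_lintegral hjk.le hf (by fun_prop)
    (Filter.Eventually.of_forall fun ζ => by positivity) (by fun_prop)
    (fun τ => by positivity) (by unfold ratConst; positivity) fun F hF => ?_
  refine lintegral_radonKernel_mul hjk (w := fun r => ENNReal.ofReal (1 / (1 + r ^ 2) ^ ((n : ℝ) / 2)))
    (w' := fun r => ENNReal.ofReal (1 / (1 + r ^ 2) ^ (((n : ℝ) - j - k) / 2)))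
    -- Integration over `X` lowers the exponent from `n / 2` to `(n - j) / 2`, exactly half of `dim
    -- Xᗮ`. This is the exponent for which the mean over `G_k(Xᗮ)` has a closed form, with constant
    -- `1`; so `c` is just `ratConst n j`.
    (W := fun s => ENNReal.ofReal (ratConst n j) *
      ENNReal.ofReal ((1 + s ^ 2) ^ (-(((n : ℝ) - j) / 2)))) (by fun_prop) (by fun_prop)
      (by fun_prop) (fun X s hs => ?_) (fun X z => ?_) hF
  · have h := lintegral_rpow_neg_norm_sq_add (V := X.1) (a := 1 + s ^ 2) (p := (n : ℝ) / 2)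
      (by positivity) (by rw [X.2]; linarith)
    rw [X.2] at h
    rw [← ENNReal.ofReal_mul (by unfold ratConst; positivity), ratConst,
      show (-(((n : ℝ) - j) / 2)) = (j : ℝ) / 2 - n / 2 by ring,
      show ((n : ℝ) - j) / 2 = n / 2 - j / 2 by ring, ← h]
    refine lintegral_congr fun y => ?_
    rw [Real.sq_sqrt (by positivity), one_div, ← Real.rpow_neg (by positivity)]
    congr 2; ring
  · have hf1 : (finrank ℝ X.1ᗮ : ℝ) = (n : ℝ) - j := by
      rw [X.finrank_orthogonal, finrank_euclideanSpace_fin]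
    have hf2 : finrank ℝ X.1ᗮ = n - j := X.finrank_orthogonal_nat
    have h := lintegral_grMeasure_one_add_norm_rpow (V := X.1ᗮ) (k := k)
      (by rw [hf2]; omega) z
    rw [hf1] at h
    have hm : Measurable fun Y : Gr ↥(X.1ᗮ) k =>
        ENNReal.ofReal ((1 + ‖z - Y.1.starProjection z‖ ^ 2) ^ (-(((n : ℝ) - j) / 2))) := by
      have := Gr.measurable_norm_sub_starProjection (k := k) z
      fun_prop
    rw [lintegral_const_mul _ hm, h, Real.rpow_neg (by positivity), one_div]

theorem mainTheorem9 (n j k : ℕ) (hj : 0 < j) (hk : 0 < k) (hjk : j + k < n) :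
    (∀ f : AffGr n j → ℂ, AEStronglyMeasurable f (affMeasure n j) →
      (∀ μ : ℝ, (j : ℝ) < μ → μ < (n : ℝ) - k →
        RadonFormula j k f (fun ζ => 1 / ζ.dist0 ^ μ) (fun τ => 1 / τ.dist0 ^ (μ - j))
          (powConst n k j μ)) ∧
      RadonFormula j k f (fun ζ => 1 / (1 + ζ.dist0 ^ 2) ^ ((n : ℝ) / 2))
        (fun τ => 1 / (1 + τ.dist0 ^ 2) ^ (((n : ℝ) - j - k) / 2)) (ratConst n j)) ∧
    (∀ φ : AffGr n k → ℂ, AEStronglyMeasurable φ (affMeasure n k) →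
      (∀ μ : ℝ, (k : ℝ) < μ → μ < (n : ℝ) - j →
        RadonFormula k j φ (fun τ => 1 / τ.dist0 ^ μ) (fun ζ => 1 / ζ.dist0 ^ (μ - k))
          (powConst n j k μ)) ∧
      RadonFormula k j φ (fun τ => 1 / (1 + τ.dist0 ^ 2) ^ ((n : ℝ) / 2))
        (fun ζ => 1 / (1 + ζ.dist0 ^ 2) ^ (((n : ℝ) - j - k) / 2)) (ratConst n k)) := by
  have hkj : k + j < n := by omega
  refine ⟨fun f hf => ⟨fun μ h1 h2 => radonFormula_rpow hj hk hjk hf h1 h2,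
    radonFormula_one_add_sq hjk hf⟩, fun φ hφ => ⟨fun μ h1 h2 =>
      radonFormula_rpow hk hj hkj hφ h1 h2, ?_⟩⟩
  -- Interchanging `j` and `k` produces the exponent `n - k - j`, which is reordered to `n - j - k`.
  simpa only [sub_right_comm (n : ℝ) (k : ℝ) (j : ℝ)] using radonFormula_one_add_sq hkj hφ

end
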